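/- A (left) skew brace is a set $B$ with two group structures $(B,\cdot)$ and $(B,\circ)$ such that $a\circ(b\cdot c)=(a\circ b)\cdot a^{-1}\cdot(a\circ c)$ for all $a,b,c$, where $a^{-1}$ is the inverse in $(B,\cdot)$; morphisms respect both operations. Skew braces are counted up to isomorphism. Write $\mathbf Z_p^*$ for the unit group of $\mathbf Z/p$. Let $p$ be a prime and $n$ a positive integer not divisible by $p$ such that every group of order $np$ has a normal subgroup of order $p$. For a skew brace $B$ of size $n$ let $\operatorname{Aut}(B)$ be its group of skew brace automorphisms, $\mathrm{Hom}(B,\mathbf Z_p^*)$ the set of maps $B\to\mathbf Z_p^*$ that are homomorphisms for both $\cdot$ and $\circ$, and $H=H_B=\mathrm{Hom}((B,\circ),\mathbf Z_p^*)$. The group $\operatorname{Aut}(B)$ acts on $\mathrm{Hom}(B,\mathbf Z_p^*)$ and on $H$ by composition; for $\sigma\in\mathrm{Hom}(B,\mathbf Z_p^*)$ put $A_\sigma=\operatorname{Aut}(B)\cap\mathrm{Stab}_{\operatorname{Aut}(B,\cdot)}(\sigma)$, and let $R_B$ be a system of representatives for the orbits of $\operatorname{Aut}(B)$ on $\mathrm{Hom}(B,\mathbf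 Z_p^*)$. Let $B$ run over a system of representatives for the isomorphism classes of skew braces of size $n$. An additive structure of skew braces of size $np$ is a pair $(B,\sigma)$ of a skew brace $B$ of size $n$ and a homomorphism $\sigma:(B,\cdot)\to\mathbf Z_p^*$ for which there are a skew brace $C$ of size $np$ and an isomorphism $(C,\cdot)\cong\mathbf Z_p\rtimes_\sigma(B,\cdot)$ such that the projection $C\to B$ is a morphism of skew braces; $(B,\sigma)$ and $(B',\sigma')$ are identified if $\sigma=\sigma'g$ for an isomorphism of skew braces $g:B\to B'$. For $\sigma\in\mathrm{Hom}(B,\mathbf Z_p^*)$ and $\tau\in H$, the double semidirect product of the trivial skew brace $\mathbf Z_p$ and $B$ via $\sigma,\tau$ is $\mathbf Z_p\times B$ with $$(m,a)\cdot(m',a')=(m+\sigma(a)m',\,a\cdot a'),\qquad (m,a)\circ(m',a')=(m+\tau(a)m',\,a\circ a'),$$ the semidirect product via $\tau$ if $\sigma=1$; the mirror double semidirect product has the same $\circ$ and $(m,a)\cdot(m',a')=(\sigma(a')^{-1}m+m',\,a\cdot a')$. **Theorem.** (1) The number of additive structures of skew braces of size $np$ is $$\sum_{B}\frac1{|\operatorname{Aut}(B)|}\sum_{\sigma\in\mathrm{Hom}(B,\mathbf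 Z_p^*)}|\mathrm{Stab}_{\operatorname{Aut}(B)}(\sigma)|=\sum_{B}\frac1{|\operatorname{Aut}(B)|}\sum_{g\in\operatorname{Aut}(B)}|\mathrm{Fix}_{\mathrm{Hom}(B,\mathbf Z_p^*)}(g)|.$$ (2) The total number of skew braces of size $np$ is $$\sum_{B}\Bigl(\frac1{|A_1|}\sum_{\tau\in H}|\mathrm{Stab}_{A_1}(\tau)|+2\sum_{\sigma\in R_B,\ \sigma\ne1}\frac1{|A_\sigma|}\sum_{\tau\in H}|\mathrm{Stab}_{A_\sigma}(\tau)|\Bigr)$$ $$=\sum_{B}\Bigl(\frac1{|A_1|}\sum_{g\in A_1}|\mathrm{Fix}_{H}(g)|+2\sum_{\sigma\in R_B,\ \sigma\ne1}\frac1{|A_\sigma|}\sum_{g\in A_\sigma}|\mathrm{Fix}_{H}(g)|\Bigr).$$ (3) One has $A_1=\operatorname{Aut}(B)$, and the term of $B$ with $\sigma=1$ in the first formula of (2) is the number of skew braces of size $np$ that are semidirect products of the trivial skew brace $\mathbf Z_p$ and $B$. For $\sigma\in R_B$, $\sigma\neq1$, the number $\frac1{|A_\sigma|}\sum_{\tau\in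 H}|\mathrm{Stab}_{A_\sigma}(\tau)|$ counts the skew braces of size $np$ that are double semidirect products via $\sigma$ and some $\tau\in H$; it also counts those that are mirror double semidirect products via $\sigma$ and some $\tau\in H$; and no skew brace is of both kinds for this $\sigma$. Every skew brace of size $np$ is, for exactly one $B$ and exactly one $\sigma\in R_B$, a double or a mirror double semidirect product via $\sigma$ and some $\tau\in H$. -/

import Mathlib

/-- A skew (left) brace: a set `B` with two group structures, the additive one `(B, ·)` (the
`Group` structure of `B`) and the multiplicative one `(B, ∘)` (the field `circGroup`), such that
`a ∘ (b · c) = (a ∘ b) · a⁻¹ · (a ∘ c)`, with `a⁻¹` the inverse of `a` in `(B, ·)`. -/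
class SkewBrace (B : Type*) extends Group B where
  circGroup : Group B
  brace : ∀ a b c : B,
    circGroup.mul a (b * c) = circGroup.mul a b * a⁻¹ * circGroup.mul a c

namespace SkewBrace

/-- The multiplicative operation `a ∘ b` of a skew brace. -/
def circ {B : Type*} [SkewBrace B] (a b : B) : B := (circGroup : Group B).mul a b

/-- A copy of the set `B`, carrying the multiplicative group `(B, ∘)`. -/
def Circ (B : Type*) : Type _ := B

/-- The identity map from `B` to its copy `Circ B`. -/
def toCirc {B : Type*} : B ≃ Circ B := Equiv.refl B

instance {B : Type*} [SkewBrace B] : Group (Circ B) := (circGroup : Group B)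

theorem toCirc_circ {B : Type*} [SkewBrace B] (a b : B) :
    toCirc (circ a b) = toCirc a * toCirc b := rfl

/-- Isomorphisms of skew braces: bijections that respect both operations. -/
structure Iso (A B : Type*) [SkewBrace A] [SkewBrace B] extends A ≃* B where
  map_circ : ∀ a b : A, toFun (circ a b) = circ (toFun a) (toFun b)

namespace Iso

variable {A B C : Type*} [SkewBrace A] [SkewBrace B] [SkewBrace C]

/-- The identity isomorphism. -/
def refl (A : Type*) [SkewBrace A] : Iso A A :=
  { MulEquiv.refl A with map_circ := fun _ _ => rfl }

/-- The inverse isomorphism. -/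
def symm (f : Iso A B) : Iso B A :=
  { f.toMulEquiv.symm with
    map_circ := fun a b => by
      apply f.toMulEquiv.injective
      have h := f.map_circ (f.toMulEquiv.symm a) (f.toMulEquiv.symm b)
      change f.toMulEquiv (circ (f.toMulEquiv.symm a) (f.toMulEquiv.symm b)) =
        circ (f.toMulEquiv (f.toMulEquiv.symm a)) (f.toMulEquiv (f.toMulEquiv.symm b)) at h
      change f.toMulEquiv (f.toMulEquiv.symm (circ a b)) =
        f.toMulEquiv (circ (f.toMulEquiv.symm a) (f.toMulEquiv.symm b))
      rw [h]
      simp }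

/-- The composite of two isomorphisms. -/
def trans (f : Iso A B) (g : Iso B C) : Iso A C :=
  { f.toMulEquiv.trans g.toMulEquiv with
    map_circ := fun a b =>
      (congrArg g.toFun (f.map_circ a b)).trans (g.map_circ (f.toFun a) (f.toFun b)) }

end Iso

section Stabilizers

variable (B : Type*) [SkewBrace B]

/-- `Aut(B)`, the group of skew brace automorphisms, as a subgroup of `Aut(B, ·)`. -/
def autBrace : Subgroup (MulAut B) where
  carrier := {g | ∀ a b : B, g (circ a b) = circ (g a) (g b)}
  one_mem' := fun _ _ => rfl
  mul_mem' := fun {g h} hg hh a b => by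
    change g (h (circ a b)) = circ (g (h a)) (g (h b))
    rw [hh, hg]
  inv_mem' := fun {g} hg a b => by
    apply g.injective
    rw [hg]
    simp

variable (p : ℕ)

/-- `Hom(B, ℤ_p^*)`: the maps to the group `ℤ_p^*` that are homomorphisms both for `·` and for
`∘`, i.e. the morphisms of skew braces to the trivial skew brace on `ℤ_p^*`. -/
def braceHom : Set (B →* (ZMod p)ˣ) := {σ | ∀ a b : B, σ (circ a b) = σ a * σ b}

variable {B p}

/-- The stabilizer in `Aut(B, ·)` of `σ ∈ Hom((B, ·), ℤ_p^*)` under `(g, σ) ↦ σ g`. -/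
def stabDot (σ : B →* (ZMod p)ˣ) : Subgroup (MulAut B) where
  carrier := {g | ∀ b : B, σ (g b) = σ b}
  one_mem' := fun _ => rfl
  mul_mem' := fun {g h} hg hh b => (hg (h b)).trans (hh b)
  inv_mem' := fun {g} hg b => by
    have h := hg (g⁻¹ b)
    rw [MulAut.apply_inv_self] at h
    exact h.symm

/-- The automorphisms `g ∈ Aut(B, ·)` with `τ g = τ`, for `τ ∈ Hom((B, ∘), ℤ_p^*)`. -/
def stabCirc (τ : Circ B →* (ZMod p)ˣ) : Subgroup (MulAut B) where
  carrier := {g | ∀ b : B, τ (toCirc (g b)) = τ (toCirc b)}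
  one_mem' := fun _ => rfl
  mul_mem' := fun {g h} hg hh b => (hg (h b)).trans (hh b)
  inv_mem' := fun {g} hg b => by
    have h := hg (g⁻¹ b)
    rw [MulAut.apply_inv_self] at h
    exact h.symm

/-- `A_σ = Aut(B) ∩ Stab_{Aut(B, ·)}(σ)`. -/
def autStab (σ : B →* (ZMod p)ˣ) : Subgroup (MulAut B) := autBrace B ⊓ stabDot σ

/-- The set of fixed points of `g` in `Hom(B, ℤ_p^*)`. -/
def fixBraceHom (p : ℕ) (g : MulAut B) : Set (B →* (ZMod p)ˣ) :=
  {σ | σ ∈ braceHom B p ∧ ∀ b : B, σ (g b) = σ b}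

/-- The set of fixed points of `g` in `H = Hom((B, ∘), ℤ_p^*)`. -/
def fixCircHom (p : ℕ) (g : MulAut B) : Set (Circ B →* (ZMod p)ˣ) :=
  {τ | ∀ b : B, τ (toCirc (g b)) = τ (toCirc b)}

/-- `R` is a system of representatives for the orbits of `Aut(B)` on `Hom(B, ℤ_p^*)`. -/
def IsOrbitReps (R : Set (B →* (ZMod p)ˣ)) : Prop :=
  R ⊆ braceHom B p ∧
    ∀ σ ∈ braceHom B p, ∃! r, r ∈ R ∧ ∃ g ∈ autBrace B, ∀ b : B, σ (g b) = r b

end Stabilizers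

section Products

variable {p : ℕ} {B : Type*} [SkewBrace B]

/-- The skew brace `C` is isomorphic to the double semidirect product of the trivial brace `ℤ_p`
and `B` via `σ` and `τ`, i.e. to `ℤ_p × B` with
`(m, a) · (n, b) = (m + σ(a) n, a · b)` and `(m, a) ∘ (n, b) = (m + τ(a) n, a ∘ b)`
(here `Aut(ℤ_p)` is identified with `ℤ_p^*`). For `σ = 1` this is the semidirect product of the
two skew braces via `τ`. -/
def IsDoubleSemidirect (C : Type*) [SkewBrace C] (σ : B →* (ZMod p)ˣ)
    (τ : Circ B →* (ZMod p)ˣ) : Prop :=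
  ∃ e : C ≃ ZMod p × B,
    (∀ x y : C, e (x * y) = ((e x).1 + (σ (e x).2 : ZMod p) * (e y).1, (e x).2 * (e y).2)) ∧
    ∀ x y : C, e (circ x y) =
      ((e x).1 + (τ (toCirc (e x).2) : ZMod p) * (e y).1, circ (e x).2 (e y).2)

/-- The mirror version, in which `ℤ_p` is written as the right hand factor of the additive group:
`C` is isomorphic to `ℤ_p × B` with
`(m, a) · (n, b) = (σ(b)⁻¹ m + n, a · b)` and `(m, a) ∘ (n, b) = (m + τ(a) n, a ∘ b)`.
The map `(m, a) ↦ (σ(a) m, a)` identifies this additive group with `ℤ_p ⋊_σ (B, ·)`. -/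
def IsMirrorDoubleSemidirect (C : Type*) [SkewBrace C] (σ : B →* (ZMod p)ˣ)
    (τ : Circ B →* (ZMod p)ˣ) : Prop :=
  ∃ e : C ≃ ZMod p × B,
    (∀ x y : C, e (x * y) =
      (((σ (e y).2)⁻¹ : (ZMod p)ˣ) * (e x).1 + (e y).1, (e x).2 * (e y).2)) ∧
    ∀ x y : C, e (circ x y) =
      ((e x).1 + (τ (toCirc (e x).2) : ZMod p) * (e y).1, circ (e x).2 (e y).2)

/-- The skew brace `C` has additive structure `(B, σ)`: the group `(C, ·)` is isomorphic to
`ℤ_p ⋊_σ (B, ·)` in such a way that the projection `C → B` is a morphism of skew braces. -/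
def HasAdditiveStructure (C : Type*) [SkewBrace C] (σ : B →* (ZMod p)ˣ) : Prop :=
  ∃ e : C ≃ ZMod p × B,
    (∀ x y : C, e (x * y) = ((e x).1 + (σ (e x).2 : ZMod p) * (e y).1, (e x).2 * (e y).2)) ∧
    ∀ x y : C, (e (circ x y)).2 = circ (e x).2 (e y).2

end Products

end SkewBrace

open SkewBrace

/-- The skew braces of size `m`. -/
structure FinSkewBrace (m : ℕ) where
  carrier : Type
  [str : SkewBrace carrier]
  [fin : Finite carrier]
  card_eq : Nat.card carrier = m

namespace FinSkewBrace

instance (m : ℕ) : CoeSort (FinSkewBrace m) Type := ⟨FinSkewBrace.carrier⟩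

instance {m : ℕ} (B : FinSkewBrace m) : SkewBrace B := B.str

instance {m : ℕ} (B : FinSkewBrace m) : Finite B := B.fin

/-- Isomorphism of skew braces of size `m`. -/
instance isoSetoid (m : ℕ) : Setoid (FinSkewBrace m) where
  r A B := Nonempty (Iso A B)
  iseqv :=
    { refl := fun A => ⟨Iso.refl A⟩
      symm := fun ⟨f⟩ => ⟨f.symm⟩
      trans := fun ⟨f⟩ ⟨g⟩ => ⟨f.trans g⟩ }

/-- The number of isomorphism classes of skew braces of size `m`. -/
noncomputable def count (m : ℕ) : ℕ := Nat.card (Quotient (isoSetoid m))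

/-- The number of isomorphism classes of skew braces of size `m` with the property `P`. -/
noncomputable def countWith (m : ℕ) (P : FinSkewBrace m → Prop) : ℕ :=
  Nat.card {q : Quotient (isoSetoid m) // ∃ C : FinSkewBrace m, P C ∧ Quotient.mk _ C = q}

/-- `B` is a system of representatives for the isomorphism classes of skew braces of size `m`. -/
def IsReps {m : ℕ} {ι : Type} (B : ι → FinSkewBrace m) : Prop :=
  ∀ C : FinSkewBrace m, ∃! i, Nonempty (Iso C (B i))

end FinSkewBrace

/-- The additive structures of skew braces of size `np`: the pairs of a skew brace `B` of size `n`
and a homomorphism `σ : (B, ·) → ℤ_p^*` for which there is a skew brace of size `np` with additive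
structure `(B, σ)`. -/
structure NpAdditiveStructure (n p : ℕ) where
  B : FinSkewBrace n
  σ : B →* (ZMod p)ˣ
  realized : ∃ C : FinSkewBrace (n * p), HasAdditiveStructure C σ

namespace NpAdditiveStructure

/-- `(B, σ)` and `(B', σ')` are identified if `σ = σ' g` for a skew brace isomorphism
`g : B → B'`. -/
instance isoSetoid (n p : ℕ) : Setoid (NpAdditiveStructure n p) where
  r X Y := ∃ g : Iso X.B Y.B, ∀ b, Y.σ (g.toFun b) = X.σ b
  iseqv :=
    { refl := fun X => ⟨Iso.refl X.B, fun _ => rfl⟩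
      symm := fun {X Y} ⟨g, hg⟩ => ⟨g.symm, fun b => by
        have h := hg (g.toMulEquiv.symm b)
        change Y.σ (g.toMulEquiv (g.toMulEquiv.symm b)) = X.σ (g.toMulEquiv.symm b) at h
        rw [MulEquiv.apply_symm_apply] at h
        exact h.symm⟩
      trans := fun ⟨g, hg⟩ ⟨h, hh⟩ => ⟨g.trans h, fun b => (hh (g.toFun b)).trans (hg b)⟩ }

/-- The number of additive structures of skew braces of size `np`, up to isomorphism. -/
noncomputable def count (n p : ℕ) : ℕ := Nat.card (Quotient (isoSetoid n p))

end NpAdditiveStructure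

open FinSkewBrace

/-!
A normal subgroup of order `p` in a group of order `np` with `p ∤ n` is characteristic, so in a
skew brace `C` of size `np` the additive and the multiplicative one coincide and form an ideal:
`C` is an extension of a skew brace `B` of size `n` by the trivial skew brace `ℤ_p`. Let `σ` and `τ`
be the actions of `B` on `ℤ_p` by conjugation in the two groups. The multiplication
`φ(x) ∘ c = φ(ε(π c) x) · c` by elements of `ℤ_p` defines a third character `ε` of `(B, ∘)`. The
skew brace law says that `ε - 1` is a crossed homomorphism `(B, ·) → ℤ_p`; as `|B|` is a unit
modulo `p`, it is principal, `ε = 1 + k (1 - σ)`, and multiplicativity forces `ε = 1` or `ε = σ`.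
In both cases averaging over `B` produces one coordinate `C → ℤ_p` that splits the additive and the
multiplicative extension at once, and `C` is a double semidirect product (`ε = 1`) or a mirror one
(`ε = σ`).

As `ℤ_p` is the set of elements of order dividing `p`, an isomorphism between two such products
induces an isomorphism of the quotients `B` that is compatible with all the characters, and
conversely. Isomorphism classes are thus orbits of `Aut(B)` and its subgroups on sets of
characters, and Burnside's lemma counts them.
-/

section

variable {p : ℕ}

theorem eq_apply_one_mul_of_additive (f : ZMod p → ZMod p) (hf : ∀ x y, f (x + y) = f x + f y)
    (x : ZMod p) : f x = f 1 * x := by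
  simpa [mul_comm] using ((AddMonoidHom.mk' f hf).toZModLinearMap p).map_smul x 1

theorem exists_units_hom_of_additive {G : Type*} [Group G] (act : G → ZMod p → ZMod p)
    (hadd : ∀ g x y, act g (x + y) = act g x + act g y)
    (hmul : ∀ g h x, act (g * h) x = act g (act h x)) (hone : ∀ x, act 1 x = x) :
    ∃ χ : G →* (ZMod p)ˣ, ∀ g x, act g x = χ g * x :=
  have act_eq g := eq_apply_one_mul_of_additive (act g) (hadd g)
  let χ : G →* ZMod p :=
    { toFun := fun g => act g 1
      map_one' := hone 1
      map_mul' := fun g h => (hmul g h 1).trans (act_eq g _) }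
  ⟨χ.toHomUnits, act_eq⟩

theorem units_hom_eq_one_of_pow_eq_one [Fact p.Prime] {G : Type*} [Monoid G]
    (χ : G →* (ZMod p)ˣ) {g : G} (hg : g ^ p = 1) : χ g = 1 := by
  have hpow : χ g ^ p = 1 := by rw [← map_pow, hg, map_one]
  rwa [← pow_sub_one_mul (Fact.out : p.Prime).ne_zero, ZMod.units_pow_card_sub_one_eq_one,
    one_mul] at hpow

end

theorem eq_one_or_eq_of_affine {R M : Type*} [CommRing R] [IsDomain R] [Monoid M] {ψ χ : M →* Rˣ}
    {k : R} (h : ∀ a, (ψ a : R) = 1 + k * (1 - χ a)) : ψ = 1 ∨ ψ = χ := by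
  have key a b : k * (1 + k) * ((1 - χ a) * (1 - χ b)) = (0 : R) := by
    have hab := h (a * b)
    rw [map_mul, map_mul, Units.val_mul, Units.val_mul, h, h] at hab
    linear_combination hab
  by_cases hχ : ∀ a, (χ a : R) = 1
  · exact .inl (MonoidHom.ext fun a => Units.ext <| by simp [h, hχ])
  · obtain ⟨a, ha⟩ := not_forall.1 hχ
    have ha : 1 - (χ a : R) ≠ 0 := sub_ne_zero.2 (Ne.symm ha)
    rcases mul_eq_zero.1 ((mul_eq_zero.1 (key a a)).resolve_right (mul_ne_zero ha ha)) with hk | hk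
    · exact .inl (MonoidHom.ext fun b => Units.ext <| by simp [h, hk])
    · exact .inr (MonoidHom.ext fun b => Units.ext <| by
        rw [h]; linear_combination (1 - (χ b : R)) * hk)

/-- `G` is an extension of `Q` by the additive group of `R`, on which `Q` acts through the
character `χ`. The maps are unbundled so that the same `φ` and `π` can serve both groups of a skew
brace. -/
structure IsScalarExtension {R G Q : Type*} [CommRing R] [Group G] [Group Q] (φ : R → G)
    (π : G → Q) (χ : Q →* Rˣ) : Prop where
  map_add : ∀ x y, φ (x + y) = φ x * φ y
  map_mul : ∀ c d, π (c * d) = π c * π d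
  injective : Function.Injective φ
  surjective : Function.Surjective π
  eq_one_iff : ∀ c, π c = 1 ↔ ∃ x, φ x = c
  mul_base : ∀ c x, c * φ x = φ (χ (π c) * x) * c

/-- A splitting of an extension of `Q` by `R`: a crossed homomorphism `G → R` that is a retraction
of `φ`. -/
structure IsSplitting {R G Q : Type*} [CommRing R] [Group G] [Group Q] (φ : R → G)
    (π : G → Q) (χ : Q →* Rˣ) (m : G → R) : Prop where
  map_mul : ∀ c d, m (c * d) = m c + χ (π c) * m d
  map_base : ∀ x, m (φ x) = x

section

variable {R G Q : Type*} [CommRing R] [Group G] [Group Q] [Fintype Q]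

/-- The average over `Q` of the functions `d ↦ χ(q)⁻¹ (m (s(q) d) - m (s(q)))`. It turns a
retraction of `φ` into a crossed homomorphism. -/
noncomputable def crossedAverage (χ : Q →* Rˣ) (s : Q → G) (m : G → R) (d : G) : R :=
  Ring.inverse (Nat.card Q : R) * ∑ q, ↑(χ q)⁻¹ * (m (s q * d) - m (s q))

theorem crossedAverage_eq_of_forall {χ : Q →* Rˣ} {s : Q → G} {m : G → R} {c d₁ d₂ : G} {k₁ k₂ : R}
    (hm : ∀ a, m (a * c) - m a = k₁ * (m (a * d₁) - m a) + k₂ * (m (a * d₂) - m a)) :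
    crossedAverage χ s m c = k₁ * crossedAverage χ s m d₁ + k₂ * crossedAverage χ s m d₂ := by
  simp only [crossedAverage, hm, mul_add, Finset.sum_add_distrib, Finset.mul_sum, mul_left_comm]

end

namespace IsScalarExtension

section

variable {R G Q : Type*} [CommRing R] [Group G] [Group Q] {φ : R → G} {π : G → Q} {χ : Q →* Rˣ}

theorem of_bijective {m : G → R} (hπ : ∀ c d, π (c * d) = π c * π d)
    (hm : IsSplitting φ π χ m) (hφ : ∀ x, π (φ x) = 1)
    (hbij : Function.Bijective fun c => (m c, π c)) : IsScalarExtension φ π χ where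
  map_mul := hπ
  surjective := Prod.snd_surjective.comp hbij.surjective
  injective := Function.LeftInverse.injective hm.map_base
  map_add x y := hbij.injective <| by simp [hπ, hφ, hm.map_mul, hm.map_base]
  eq_one_iff c :=
    ⟨fun hc => ⟨m c, hbij.injective <| by simp [hφ, hm.map_base, hc]⟩,
      fun ⟨x, hx⟩ => hx ▸ hφ x⟩
  mul_base c x := hbij.injective <| by simp [hπ, hφ, hm.map_mul, hm.map_base, add_comm]

/-- The projection as a group homomorphism. -/
def toHom (h : IsScalarExtension φ π χ) : G →* Q := MonoidHom.mk' π h.map_mul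

theorem toHom_apply (h : IsScalarExtension φ π χ) (c : G) : h.toHom c = π c := rfl

theorem map_zero (h : IsScalarExtension φ π χ) : φ 0 = 1 := by
  simpa using h.map_add 0 0

theorem map_base (h : IsScalarExtension φ π χ) (x : R) : π (φ x) = 1 :=
  (h.eq_one_iff _).2 ⟨x, rfl⟩

theorem map_base_mul (h : IsScalarExtension φ π χ) (x : R) (c : G) : π (φ x * c) = π c := by
  rw [h.map_mul, h.map_base, one_mul]

theorem exists_eq_base_mul (h : IsScalarExtension φ π χ) {c d : G} (hcd : π c = π d) :
    ∃ x, c = φ x * d := by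
  have hker : π (c * d⁻¹) = 1 := by
    rw [← h.toHom_apply, _root_.map_mul, map_inv, h.toHom_apply, h.toHom_apply, hcd,
      mul_inv_cancel]
  obtain ⟨x, hx⟩ := (h.eq_one_iff _).1 hker
  exact ⟨x, by rw [hx, inv_mul_cancel_right]⟩

theorem bijective (h : IsScalarExtension φ π χ) {m : G → R}
    (hm : ∀ x c, m (φ x * c) = x + m c) : Function.Bijective fun c => (m c, π c) := by
  constructor
  · intro c d hcd
    obtain ⟨hmcd, hπcd⟩ := Prod.mk.inj hcd
    obtain ⟨x, rfl⟩ := h.exists_eq_base_mul hπcd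
    rw [hm, add_eq_right] at hmcd
    rw [hmcd, h.map_zero, one_mul]
  · rintro ⟨x, q⟩
    obtain ⟨c, rfl⟩ := h.surjective q
    exact ⟨φ (x - m c) * c, by simp only [hm, h.map_base_mul, sub_add_cancel]⟩

theorem pow_base (h : IsScalarExtension φ π χ) (x : R) (k : ℕ) : φ x ^ k = φ (k * x) := by
  induction k with
  | zero => simp [h.map_zero]
  | succ k ih => rw [pow_succ, ih, ← h.map_add, Nat.cast_succ, add_one_mul]

theorem map_eq_one_iff_pow {p : ℕ} [CharP R p] (h : IsScalarExtension φ π χ)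
    (hQ : (Nat.card Q).Coprime p) {c : G} : π c = 1 ↔ c ^ p = 1 := by
  constructor
  · intro hc
    obtain ⟨x, rfl⟩ := (h.eq_one_iff c).1 hc
    simp [h.pow_base, h.map_zero]
  · intro hc
    refine (powCoprime hQ).injective (?_ : π c ^ p = 1 ^ p)
    rw [← h.toHom_apply, ← map_pow, hc, map_one, one_pow]

theorem crossedAverage_mul [Fintype Q] (h : IsScalarExtension φ π χ) {s : Q → G}
    (hs : ∀ q, π (s q) = q) {m : G → R} (hm : ∀ x c, m (φ x * c) = x + m c) (c d : G) :
    crossedAverage χ s m (c * d) = crossedAverage χ s m c + χ (π c) * crossedAverage χ s m d := by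
  have shift : ∑ q, ↑(χ q)⁻¹ * (m (s q * (c * d)) - m (s q * c)) =
      χ (π c) * ∑ q, ↑(χ q)⁻¹ * (m (s q * d) - m (s q)) := by
    rw [Finset.mul_sum]
    refine Fintype.sum_equiv (Equiv.mulRight (π c)) _ _ fun q => ?_
    obtain ⟨x, hx⟩ := h.exists_eq_base_mul (c := s q * c) (d := s (q * π c))
      (by rw [h.map_mul, hs, hs])
    rw [← mul_assoc, hx, mul_assoc, hm, hm, add_sub_add_left_eq_sub, Equiv.coe_mulRight,
      _root_.map_mul, mul_inv_rev, ← mul_assoc, ← Units.val_mul, mul_inv_cancel_left]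
  simp only [crossedAverage]
  rw [mul_left_comm, ← shift, ← mul_add, ← Finset.sum_add_distrib]
  simp only [← mul_add, sub_add_sub_cancel']

theorem crossedAverage_isSplitting [Fintype Q] (h : IsScalarExtension φ π χ)
    (hQ : IsUnit (Nat.card Q : R)) {s : Q → G} (hs : ∀ q, π (s q) = q) {m : G → R}
    (hm : ∀ x c, m (φ x * c) = x + m c) : IsSplitting φ π χ (crossedAverage χ s m) where
  map_mul := h.crossedAverage_mul hs hm
  map_base x := by
    have summand q : ↑(χ q)⁻¹ * (m (s q * φ x) - m (s q)) = x := by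
      rw [h.mul_base, hm, hs, add_sub_cancel_right, Units.inv_mul_cancel_left]
    simp only [crossedAverage, summand, Finset.sum_const, Finset.card_univ, nsmul_eq_mul,
      ← Nat.card_eq_fintype_card, Ring.inverse_mul_cancel_left _ _ hQ]

theorem exists_isSplitting [Finite Q] (h : IsScalarExtension φ π χ)
    (hQ : IsUnit (Nat.card Q : R)) : ∃ m, IsSplitting φ π χ m := by
  have := Fintype.ofFinite Q
  let s := Function.surjInv h.surjective
  have hs : ∀ q, π (s q) = q := Function.surjInv_eq h.surjective
  choose m hm using fun c => h.exists_eq_base_mul (hs (π c)).symm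
  refine ⟨_, h.crossedAverage_isSplitting hQ hs (m := m) fun x c => h.injective ?_⟩
  refine mul_right_cancel (b := s (π c)) ?_
  rw [← h.map_base_mul x c, ← hm, h.map_base_mul, h.map_add, mul_assoc, ← hm]

/-- Comparing the two actions in `f (c φ(x)) = f (φ(χ(c) x) c)`. -/
theorem char_map {G' Q' : Type*} [Group G'] [Group Q'] {φ' : R → G'} {π' : G' → Q'}
    {χ' : Q' →* Rˣ} (h : IsScalarExtension φ π χ) (h' : IsScalarExtension φ' π' χ') {f : G →* G'}
    (hf : Function.Injective f) {u : R} (hu : ∀ x, f (φ x) = φ' (u * x)) (c : G) :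
    χ' (π' (f c)) = χ (π c) := by
  have hmul : φ' (χ' (π' (f c)) * (u * 1)) = φ' (u * (χ (π c) * 1)) := by
    refine mul_right_cancel (b := f c) ?_
    rw [← h'.mul_base, ← hu, ← hu, ← _root_.map_mul, ← _root_.map_mul, h.mul_base]
  refine Units.ext (h.injective (hf ?_))
  rw [hu, hu]
  exact (congrArg φ' (by ring)).trans (hmul.trans (congrArg φ' (by ring)))

end

section

variable {p : ℕ} {G Q G' Q' : Type*} [Group G] [Group Q] [Group G'] [Group Q'] {φ : ZMod p → G}

theorem exists_scalar {π : G → Q} {χ : Q →* (ZMod p)ˣ} {φ' : ZMod p → G'} {π' : G' → Q'}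
    {χ' : Q' →* (ZMod p)ˣ} (h : IsScalarExtension φ π χ) (h' : IsScalarExtension φ' π' χ')
    {f : G →* G'} (hf : ∀ x, π' (f (φ x)) = 1) : ∃ u, ∀ x, f (φ x) = φ' (u * x) := by
  choose g hg using fun x => (h'.eq_one_iff _).1 (hf x)
  refine ⟨g 1, fun x => ?_⟩
  rw [← eq_apply_one_mul_of_additive g (fun x y => h'.injective ?_) x, hg]
  rw [h'.map_add, hg, hg, hg, h.map_add, _root_.map_mul]

theorem exists_char {π : G →* Q} (hadd : ∀ x y, φ (x + y) = φ x * φ y)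
    (hφ : Function.Injective φ) (hπ : Function.Surjective π)
    (hker : ∀ c, π c = 1 ↔ ∃ x, φ x = c) : ∃ χ : Q →* (ZMod p)ˣ, IsScalarExtension φ π χ := by
  have hconj (c x) : ∃ y, φ y = c * φ x * c⁻¹ :=
    (hker _).1 (by rw [_root_.map_mul, _root_.map_mul, (hker _).2 ⟨x, rfl⟩, mul_one, map_inv,
      mul_inv_cancel])
  choose act hact using hconj
  obtain ⟨χ, hχ⟩ := exists_units_hom_of_additive act
    (fun c x y => hφ <| by simp only [hadd, hact, conj_mul])
    (fun c d x => hφ <| by simp only [hact, mul_inv_rev, mul_assoc])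
    (fun x => hφ <| by simp only [hact, one_mul, inv_one, mul_one])
  have χ_ker : π.ker ≤ χ.ker := fun c hc => by
    obtain ⟨y, rfl⟩ := (hker c).1 hc
    refine Units.ext (hφ ?_)
    have := hact (φ y) 1
    rw [← hadd, add_comm, hadd, mul_inv_cancel_right, hχ, mul_one] at this
    rw [this, Units.val_one]
  refine ⟨π.liftOfSurjective hπ ⟨χ, χ_ker⟩, hadd, _root_.map_mul π, hφ, hπ, hker, fun c x => ?_⟩
  rw [MonoidHom.liftOfSurjective, MonoidHom.liftOfRightInverse_comp_apply, ← hχ, hact,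
    inv_mul_cancel_right]

end

end IsScalarExtension

namespace IsSplitting

variable {R G Q : Type*} [CommRing R] [Group G] [Group Q] {φ : R → G} {π : G → Q} {χ : Q →* Rˣ}
  {m : G → R}

theorem map_base_mul (hm : IsSplitting φ π χ m) (h : IsScalarExtension φ π χ) (x : R) (c : G) :
    m (φ x * c) = x + m c := by
  rw [hm.map_mul, hm.map_base, h.map_base, map_one, Units.val_one, one_mul]

end IsSplitting

theorem exists_eq_one_sub_mul_of_crossedHom {R Q : Type*} [CommRing R] [Group Q] [Finite Q]
    (hQ : IsUnit (Nat.card Q : R)) {χ : Q →* Rˣ} {D : Q → R}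
    (hD : ∀ q r, D (q * r) = D q + χ q * D r) : ∃ k, ∀ q, D q = (1 - χ q) * k := by
  have := Fintype.ofFinite Q
  refine ⟨Ring.inverse (Nat.card Q : R) * ∑ r, D r, fun q => ?_⟩
  have translate : ∑ r, D r = Nat.card Q * D q + χ q * ∑ r, D r := by
    conv_lhs => rw [← Equiv.sum_comp (Equiv.mulLeft q)]
    simp [hD, Finset.sum_add_distrib, Finset.mul_sum, Nat.card_eq_fintype_card]
  linear_combination (-D q) * Ring.inverse_mul_cancel _ hQ -
    Ring.inverse (Nat.card Q : R) * translate

namespace SkewBrace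

section Basic

variable {B : Type*} [SkewBrace B]

theorem circ_mul (a b c : B) : circ a (b * c) = circ a b * a⁻¹ * circ a c := brace a b c

theorem circ_assoc (a b c : B) : circ (circ a b) c = circ a (circ b c) :=
  mul_assoc (toCirc a) (toCirc b) (toCirc c)

theorem circ_one (a : B) : circ a 1 = a := by
  have h := circ_mul a 1 1
  rw [mul_one, mul_assoc, left_eq_mul] at h
  exact (inv_mul_eq_one.1 h).symm

theorem toCirc_one : toCirc (1 : B) = 1 :=
  mul_eq_left.1 (circ_one (1 : B) : toCirc (1 : B) * toCirc 1 = toCirc 1)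

theorem one_circ (a : B) : circ 1 a = a := by
  change toCirc (1 : B) * toCirc a = toCirc a
  rw [toCirc_one, one_mul]

theorem circ_left_cancel {a b c : B} (h : circ a b = circ a c) : b = c :=
  mul_left_cancel (a := toCirc a) h

/-- The map `λ_a : b ↦ a⁻¹ · (a ∘ b)`, an endomorphism of `(B, ·)`. -/
def lam (a : B) : B →* B :=
  MonoidHom.mk' (fun b => a⁻¹ * circ a b) fun b c => by simp [circ_mul, mul_assoc]

theorem lam_apply (a b : B) : lam a b = a⁻¹ * circ a b := rfl

theorem circ_eq_mul_lam (a b : B) : circ a b = a * lam a b := (mul_inv_cancel_left _ _).symm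

theorem lam_one_apply (b : B) : lam 1 b = b := by rw [lam_apply, one_circ, inv_one, one_mul]

theorem lam_circ (a b c : B) : lam (circ a b) c = lam a (lam b c) := by
  have h := map_mul (lam a) b (lam b c)
  rw [← circ_eq_mul_lam] at h
  rw [← mul_right_inj (lam a b), ← h]
  simp [lam_apply, circ_assoc, mul_assoc]

theorem lam_injective (a : B) : Function.Injective (lam a) := fun _ _ h =>
  circ_left_cancel (mul_left_cancel h)

end Basic

section Hom

variable {A B : Type*} [SkewBrace A] [SkewBrace B]

/-- A map of skew braces, as a map between the multiplicative groups. -/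
def circMap (f : A → B) (a : Circ A) : Circ B := toCirc (f (toCirc.symm a))

theorem Iso.apply_circ (f : Iso A B) (a b : A) :
    f.toMulEquiv (circ a b) = circ (f.toMulEquiv a) (f.toMulEquiv b) := f.map_circ a b

theorem map_lam {f : A → B} (hmul : ∀ a b, f (a * b) = f a * f b)
    (hcirc : ∀ a b, f (circ a b) = circ (f a) (f b)) (a b : A) :
    f (lam a b) = lam (f a) (f b) := by
  rw [← mul_right_inj (f a), ← hmul, ← circ_eq_mul_lam, ← circ_eq_mul_lam, hcirc]

variable {p : ℕ} {σ : B →* (ZMod p)ˣ}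

theorem apply_lam_of_mem_braceHom (hσ : σ ∈ braceHom B p) (a b : B) : σ (lam a b) = σ b := by
  rw [← mul_right_inj (σ a), ← map_mul, ← circ_eq_mul_lam, hσ]

/-- A homomorphism of both groups of a skew brace, as a homomorphism of the multiplicative one. -/
def circHom (hσ : σ ∈ braceHom B p) : Circ B →* (ZMod p)ˣ :=
  MonoidHom.mk' (fun b => σ (toCirc.symm b)) hσ

theorem circHom_toCirc (hσ : σ ∈ braceHom B p) (b : B) : circHom hσ (toCirc b) = σ b := rfl

end Hom

section Extension

variable {p : ℕ} {C B : Type*} [SkewBrace C] [SkewBrace B] {φ : ZMod p → C} {π : C → B}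
  {σ : B →* (ZMod p)ˣ} {τ : Circ B →* (ZMod p)ˣ}

theorem exists_lamChar (h : IsScalarExtension φ π σ)
    (hπ : ∀ c d, π (circ c d) = circ (π c) (π d)) :
    ∃ l : Circ C →* (ZMod p)ˣ, ∀ c x, lam c (φ x) = φ (l (toCirc c) * x) := by
  have hker (c : C) (x : ZMod p) : ∃ y, φ y = lam c (φ x) :=
    (h.eq_one_iff _).1 (by rw [map_lam h.map_mul hπ, h.map_base, map_one])
  choose act hact using hker
  obtain ⟨l, hl⟩ := exists_units_hom_of_additive (G := Circ C) (fun c => act (toCirc.symm c))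
    (fun c x y => h.injective <| by simp only [h.map_add, hact, map_mul])
    (fun c d x => h.injective <| by
      simp only [hact]
      exact lam_circ (toCirc.symm c) (toCirc.symm d) (φ x))
    (fun x => h.injective <| by
      rw [hact, ← toCirc_one, Equiv.symm_apply_apply, lam_one_apply])
  exact ⟨l, fun c x => by rw [← hl, Equiv.symm_apply_apply, hact]⟩

theorem mem_braceHom_of_isScalarExtension (h : IsScalarExtension φ π σ)
    (hπ : ∀ c d, π (circ c d) = circ (π c) (π d)) : σ ∈ braceHom B p := by
  obtain ⟨l, hl⟩ := exists_lamChar h hπ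
  intro a b
  obtain ⟨c, rfl⟩ := h.surjective a
  obtain ⟨d, rfl⟩ := h.surjective b
  rw [circ_eq_mul_lam, map_mul, ← map_lam h.map_mul hπ, h.char_map h (lam_injective c) (hl c)]

theorem map_circ_of_isScalarExtension
    (hτ : IsScalarExtension (fun x => toCirc (φ x)) (circMap π) τ) (c d : C) :
    π (circ c d) = circ (π c) (π d) := hτ.map_mul (toCirc c) (toCirc d)

theorem exists_circ_base_eq (h : IsScalarExtension φ π σ)
    (hτ : IsScalarExtension (fun x => toCirc (φ x)) (circMap π) τ) :
    ∃ ε : Circ B →* (ZMod p)ˣ, ∀ x c, circ (φ x) c = φ (ε (toCirc (π c)) * x) * c := by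
  have hπ := map_circ_of_isScalarExtension hτ
  obtain ⟨l, hl⟩ := exists_lamChar h hπ
  have l_ker : hτ.toHom.ker ≤ l.ker := fun c hc => by
    obtain ⟨x, rfl⟩ := (hτ.eq_one_iff c).1 hc
    have hcirc : circ (φ x) (φ 1) = φ (x + 1) := (hτ.map_add x 1).symm
    rw [circ_eq_mul_lam, hl, ← h.map_add, mul_one] at hcirc
    exact Units.ext (add_left_cancel (h.injective hcirc))
  let l' := hτ.toHom.liftOfSurjective hτ.surjective ⟨l, l_ker⟩
  have hl' (c : C) : l' (toCirc (π c)) = l (toCirc c) :=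
    MonoidHom.liftOfRightInverse_comp_apply _ _ (Function.rightInverse_surjInv _) ⟨l, l_ker⟩ _
  refine ⟨circHom (mem_braceHom_of_isScalarExtension h hπ) * l' * τ⁻¹, fun x c => ?_⟩
  have hc : circ (φ x) c = circ c (φ (↑(τ (toCirc (π c)))⁻¹ * x)) := by
    have := hτ.mul_base (toCirc c) (↑(τ (toCirc (π c)))⁻¹ * x)
    rw [show circMap π (toCirc c) = toCirc (π c) from rfl, Units.mul_inv_cancel_left] at this
    exact this.symm
  rw [hc, circ_eq_mul_lam, hl, ← hl', h.mul_base]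
  congr 2
  simp only [MonoidHom.mul_apply, MonoidHom.inv_apply, circHom_toCirc, Units.val_mul]
  ring

theorem circ_base_mul_eq (h : IsScalarExtension φ π σ) {η : B → ZMod p}
    (hη : ∀ x c, circ (φ x) c = φ (η (π c) * x) * c) (a b : B) :
    η (a * b) = η a + σ a * (η b - 1) := by
  obtain ⟨c, rfl⟩ := h.surjective a
  obtain ⟨d, rfl⟩ := h.surjective b
  have hinv : (φ 1)⁻¹ = φ (-1) := inv_eq_of_mul_eq_one_right (by
    rw [← h.map_add, add_neg_cancel, h.map_zero])
  refine h.injective (mul_right_cancel (b := c * d) ?_)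
  calc φ (η (π c * π d)) * (c * d) = circ (φ 1) (c * d) := by rw [hη, h.map_mul, mul_one]
    _ = φ (η (π c)) * (c * φ (-1 + η (π d))) * d := by
      rw [circ_mul, hη, hη, hinv, h.map_add]
      simp only [mul_one, mul_assoc]
    _ = φ (η (π c) + σ (π c) * (η (π d) - 1)) * (c * d) := by
      rw [h.mul_base, h.map_add, neg_add_eq_sub]
      simp only [mul_assoc]

end Extension

theorem exists_mulEquiv_of_ker_eq {G Q Q' : Type*} [Group G] [Group Q] [Group Q'] {π : G →* Q}
    {π' : G →* Q'} (hπ : Function.Surjective π) (hπ' : Function.Surjective π')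
    (hker : π.ker = π'.ker) : ∃ g : Q ≃* Q', ∀ c, g (π c) = π' c :=
  ⟨(QuotientGroup.quotientKerEquivOfSurjective π hπ).symm.trans
    ((QuotientGroup.quotientMulEquivOfEq hker).trans
      (QuotientGroup.quotientKerEquivOfSurjective π' hπ')), fun c => by
    have hc : (QuotientGroup.quotientKerEquivOfSurjective π hπ).symm (π c) = (c : G ⧸ π.ker) :=
      (MulEquiv.symm_apply_eq _).2 rfl
    rw [MulEquiv.trans_apply, hc]
    rfl⟩

/-- `C` is an extension of `B` by the trivial skew brace `ℤ_p`, where `δ` and `ε` describe the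
left and the right action of `B` on `ℤ_p` in the additive group: in suitable coordinates
`(m, a) · (n, b) = (ε(b)⁻¹ m + δ(a) n, a · b)` and `(m, a) ∘ (n, b) = (m + τ(a) n, a ∘ b)`. -/
structure IsBraceExtension {p : ℕ} {C B : Type*} [SkewBrace C] [SkewBrace B] (φ : ZMod p → C)
    (π : C → B) (δ ε : B →* (ZMod p)ˣ) (τ : Circ B →* (ZMod p)ˣ) : Prop where
  additive : IsScalarExtension φ π (δ * ε)
  multiplicative : IsScalarExtension (fun x => toCirc (φ x)) (circMap π) τ
  circ_base : ∀ x c, circ (φ x) c = φ (ε (π c) * x) * c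

/-- `C` is isomorphic to `ℤ_p × B` with `(m, a) · (n, b) = (ε(b)⁻¹ m + δ(a) n, a · b)` and
`(m, a) ∘ (n, b) = (m + τ(a) n, a ∘ b)`. The double semidirect products are the case `ε = 1`, their
mirror versions the case `δ = 1`. -/
def IsTwoSidedSemidirect {p : ℕ} {B : Type*} [SkewBrace B] (C : Type*) [SkewBrace C]
    (δ ε : B →* (ZMod p)ˣ) (τ : Circ B →* (ZMod p)ˣ) : Prop :=
  ∃ e : C ≃ ZMod p × B,
    (∀ x y : C, e (x * y) =
      (↑(ε (e y).2)⁻¹ * (e x).1 + δ (e x).2 * (e y).1, (e x).2 * (e y).2)) ∧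
    ∀ x y : C, e (circ x y) =
      ((e x).1 + τ (toCirc (e x).2) * (e y).1, circ (e x).2 (e y).2)

section

variable {p : ℕ} {C B : Type*} [SkewBrace C] [SkewBrace B] {σ : B →* (ZMod p)ˣ}
  {τ : Circ B →* (ZMod p)ˣ}

theorem isTwoSidedSemidirect_one_right :
    IsTwoSidedSemidirect C σ 1 τ ↔ IsDoubleSemidirect C σ τ := by
  simp [IsTwoSidedSemidirect, IsDoubleSemidirect]

theorem isTwoSidedSemidirect_one_left :
    IsTwoSidedSemidirect C 1 σ τ ↔ IsMirrorDoubleSemidirect C σ τ := by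
  simp [IsTwoSidedSemidirect, IsMirrorDoubleSemidirect]

theorem HasAdditiveStructure.mem_braceHom (h : HasAdditiveStructure C σ) :
    σ ∈ braceHom B p := by
  obtain ⟨e, hmul, hcirc⟩ := h
  refine mem_braceHom_of_isScalarExtension (φ := fun x => e.symm (x, 1)) (π := fun c => (e c).2)
    (.of_bijective (m := fun c => (e c).1) ?_ ⟨?_, ?_⟩ ?_ e.bijective) hcirc <;> simp [hmul]

theorem hasAdditiveStructure_of_isDoubleSemidirect (h : IsDoubleSemidirect C σ τ) :
    HasAdditiveStructure C σ := by
  obtain ⟨e, hmul, hcirc⟩ := h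
  exact ⟨e, hmul, fun x y => by rw [hcirc]⟩

end

section

variable {p : ℕ} {C B : Type*} [SkewBrace C] [SkewBrace B] {δ ε : B →* (ZMod p)ˣ}
  {τ : Circ B →* (ZMod p)ˣ}

theorem IsTwoSidedSemidirect.exists_isBraceExtension (h : IsTwoSidedSemidirect C δ ε τ) :
    ∃ (φ : ZMod p → C) (π : C → B), IsBraceExtension φ π δ ε τ := by
  obtain ⟨e, hmul, hcirc⟩ := h
  have hbij : Function.Bijective fun c => (ε (e c).2 * (e c).1, (e c).2) :=
    Function.bijective_iff_has_inverse.2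
      ⟨fun y => e.symm (↑(ε y.2)⁻¹ * y.1, y.2), fun c => by simp, fun y => by simp⟩
  refine ⟨fun x => e.symm (x, 1), fun c => (e c).2,
    .of_bijective (m := fun c => ε (e c).2 * (e c).1) ?_ ⟨fun c d => ?_, ?_⟩ ?_ hbij,
    .of_bijective (m := fun c => (e (toCirc.symm c)).1) (fun c d => ?_) ⟨fun c d => ?_, ?_⟩ ?_ ?_,
    fun x c => e.injective ?_⟩
  · simp [hmul]
  · simp only [hmul, map_mul, Units.val_mul, mul_add, MonoidHom.mul_apply]
    linear_combination (ε (e c).2 * (e c).1 : ZMod p) * (ε (e d).2).mul_inv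
  · simp
  · simp
  · exact congrArg Prod.snd (hcirc (toCirc.symm c) (toCirc.symm d))
  · exact congrArg Prod.fst (hcirc (toCirc.symm c) (toCirc.symm d))
  · simp
  · simp [circMap, toCirc_one]
  · exact e.bijective
  · simp [hmul, hcirc, one_circ, toCirc_one]

end

namespace IsBraceExtension

variable {p : ℕ} {C B : Type*} [SkewBrace C] [SkewBrace B] {φ : ZMod p → C} {π : C → B}
  {δ ε : B →* (ZMod p)ˣ} {τ : Circ B →* (ZMod p)ˣ}

theorem map_circ (h : IsBraceExtension φ π δ ε τ) (c d : C) : π (circ c d) = circ (π c) (π d) :=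
  map_circ_of_isScalarExtension h.multiplicative c d

theorem mul_mem_braceHom (h : IsBraceExtension φ π δ ε τ) : δ * ε ∈ braceHom B p :=
  mem_braceHom_of_isScalarExtension h.additive h.map_circ

theorem right_mem_braceHom (h : IsBraceExtension φ π δ ε τ) : ε ∈ braceHom B p := by
  obtain ⟨ε', hε'⟩ := exists_circ_base_eq h.additive h.multiplicative
  have hε (b : B) : ε b = ε' (toCirc b) := by
    obtain ⟨c, rfl⟩ := h.additive.surjective b
    have := (h.circ_base 1 c).symm.trans (hε' 1 c)
    exact Units.ext (by simpa using h.additive.injective (mul_right_cancel this))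
  intro a b
  rw [hε, hε, hε, toCirc_circ, map_mul]

theorem left_mem_braceHom (h : IsBraceExtension φ π δ ε τ) : δ ∈ braceHom B p := fun a b => by
  have := h.mul_mem_braceHom a b
  rw [MonoidHom.mul_apply, MonoidHom.mul_apply, MonoidHom.mul_apply, h.right_mem_braceHom,
    mul_mul_mul_comm] at this
  exact mul_right_cancel this

theorem one_sub_mul_one_sub (h : IsBraceExtension φ π δ ε τ) (a b : B) :
    (1 - δ a : ZMod p) * (1 - ε b) = 0 := by
  have := circ_base_mul_eq h.additive (η := fun b => ε b) h.circ_base a b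
  rw [map_mul, MonoidHom.mul_apply, Units.val_mul, Units.val_mul] at this
  linear_combination (-(↑(ε a)⁻¹ : ZMod p)) * this +
    (ε b - 1 - δ a * (ε b - 1)) * (ε a).inv_mul

theorem exists_retraction [Finite B] (h : IsBraceExtension φ π δ ε τ)
    (hB : IsUnit (Nat.card B : ZMod p)) :
    ∃ n : C → ZMod p, (∀ x c, n (circ (φ x) c) = x + n c) ∧
      ∀ c d, n (c * d) = ↑(ε (π d))⁻¹ * n c + δ (π c) * n d := by
  obtain ⟨m, hm⟩ := h.additive.exists_isSplitting hB
  refine ⟨fun c => ↑(ε (π c))⁻¹ * m c, fun x c => ?_, fun c d => ?_⟩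
  · beta_reduce
    rw [h.circ_base, hm.map_base_mul h.additive, h.additive.map_base_mul]
    linear_combination x * (ε (π c)).inv_mul
  · beta_reduce
    rw [hm.map_mul, h.additive.map_mul, map_mul, mul_inv, MonoidHom.mul_apply, Units.val_mul,
      Units.val_mul]
    linear_combination ((↑(ε (π d))⁻¹ : ZMod p) * δ (π c) * m d) * (ε (π c)).inv_mul

theorem retraction_circ_mul (h : IsBraceExtension φ π δ ε τ) {n : C → ZMod p}
    (hn : ∀ c d, n (c * d) = ↑(ε (π d))⁻¹ * n c + δ (π c) * n d) (a c d : C) :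
    n (circ a (c * d)) - n a =
      ↑(ε (π d))⁻¹ * (n (circ a c) - n a) + δ (π c) * (n (circ a d) - n a) := by
  have hlam (c : C) : π (lam a c) = lam (π a) (π c) := map_lam h.additive.map_mul h.map_circ a c
  have hcirc (c : C) : n (circ a c) = ↑(ε (π c))⁻¹ * n a + δ (π a) * n (lam a c) := by
    rw [circ_eq_mul_lam, hn, hlam, apply_lam_of_mem_braceHom h.right_mem_braceHom]
  rw [hcirc, hcirc, hcirc, map_mul, hn, hlam, hlam, apply_lam_of_mem_braceHom h.right_mem_braceHom,
    apply_lam_of_mem_braceHom h.left_mem_braceHom, h.additive.map_mul, map_mul, mul_inv,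
    Units.val_mul]
  linear_combination (n a * ↑(ε (π d))⁻¹) * h.one_sub_mul_one_sub (π c) (π d) +
    (n a * (1 - δ (π c))) * (ε (π d)).inv_mul

theorem isTwoSidedSemidirect [Finite B] (h : IsBraceExtension φ π δ ε τ)
    (hB : IsUnit (Nat.card B : ZMod p)) : IsTwoSidedSemidirect C δ ε τ := by
  obtain ⟨n, hbase, hmul⟩ := h.exists_retraction hB
  have : Fintype (Circ B) := Fintype.ofFinite B
  let s := Function.surjInv h.multiplicative.surjective
  have hs : ∀ b, circMap π (s b) = b := Function.surjInv_eq h.multiplicative.surjective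
  let n' : C → ZMod p := fun c => crossedAverage τ s (fun c => n (toCirc.symm c)) (toCirc c)
  have hn' : IsSplitting _ _ _ _ := h.multiplicative.crossedAverage_isSplitting hB hs
    (m := fun c => n (toCirc.symm c)) fun x c => hbase x (toCirc.symm c)
  have hbij := h.multiplicative.bijective (hn'.map_base_mul h.multiplicative)
  refine ⟨Equiv.ofBijective (fun c => (n' c, π c)) hbij, fun c d => Prod.ext ?_ ?_,
    fun c d => Prod.ext ?_ ?_⟩
  · exact crossedAverage_eq_of_forall fun a => h.retraction_circ_mul hmul (toCirc.symm a) c d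
  · exact h.additive.map_mul c d
  · exact hn'.map_mul (toCirc c) (toCirc d)
  · exact h.map_circ c d

/-- The right action `ε` is a crossed homomorphism for the additive group, hence of the form
`1 + k (1 - σ)`; as it is also a homomorphism for the multiplicative group, it is `1` or `σ`. -/
theorem of_isScalarExtension [Fact p.Prime] [Finite B] {σ : B →* (ZMod p)ˣ}
    (hB : IsUnit (Nat.card B : ZMod p)) (h : IsScalarExtension φ π σ)
    (hτ : IsScalarExtension (fun x => toCirc (φ x)) (circMap π) τ) :
    IsBraceExtension φ π σ 1 τ ∨ IsBraceExtension φ π 1 σ τ := by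
  obtain ⟨ε, hε⟩ := exists_circ_base_eq h hτ
  have hσ := mem_braceHom_of_isScalarExtension h (map_circ_of_isScalarExtension hτ)
  obtain ⟨k, hk⟩ := exists_eq_one_sub_mul_of_crossedHom hB (χ := σ)
    (D := fun b => (ε (toCirc b) - 1 : ZMod p)) fun a b => by
      rw [circ_base_mul_eq h (η := fun b => ε (toCirc b)) hε, add_sub_right_comm]
  have haffine (b : Circ B) : (ε b : ZMod p) = 1 + k * (1 - circHom hσ b) := by
    rw [← sub_eq_iff_eq_add', mul_comm]
    exact hk (toCirc.symm b)
  rcases eq_one_or_eq_of_affine haffine with rfl | rfl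
  · exact .inl ⟨(mul_one σ).symm ▸ h, hτ, hε⟩
  · exact .inr ⟨(one_mul σ).symm ▸ h, hτ, hε⟩

theorem exists_iso {C' B' : Type*} [SkewBrace C'] [SkewBrace B'] {φ' : ZMod p → C'} {π' : C' → B'}
    {δ' ε' : B' →* (ZMod p)ˣ} {τ' : Circ B' →* (ZMod p)ˣ} (h : IsBraceExtension φ π δ ε τ)
    (h' : IsBraceExtension φ' π' δ' ε' τ') (f : Iso C C')
    (hf : ∀ c, π' (f.toMulEquiv c) = 1 ↔ π c = 1) :
    ∃ g : Iso B B', (∀ b, δ' (g.toMulEquiv b) = δ b) ∧ (∀ b, ε' (g.toMulEquiv b) = ε b) ∧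
      ∀ b, τ' (toCirc (g.toMulEquiv b)) = τ (toCirc b) := by
  obtain ⟨g, hg⟩ := exists_mulEquiv_of_ker_eq (π := h.additive.toHom)
    (π' := h'.additive.toHom.comp f.toMulEquiv.toMonoidHom) h.additive.surjective
    (h'.additive.surjective.comp f.toMulEquiv.surjective) (Subgroup.ext fun c => (hf c).symm)
  replace hg (c : C) : g (π c) = π' (f.toMulEquiv c) := hg c
  obtain ⟨u, hu⟩ := h.additive.exists_scalar h'.additive (f := f.toMulEquiv.toMonoidHom)
    fun x => (hf _).2 (h.additive.map_base x)
  replace hu (x : ZMod p) : f.toMulEquiv (φ x) = φ' (u * x) := hu x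
  have hε (c : C) : ε' (π' (f.toMulEquiv c)) = ε (π c) := by
    have hcirc := f.apply_circ (φ 1) c
    rw [h.circ_base, map_mul, hu, hu, h'.circ_base, mul_left_inj] at hcirc
    refine Units.ext (h.additive.injective (f.toMulEquiv.injective ?_))
    rw [hu, hu]
    simpa [mul_comm] using hcirc.symm
  have hδε (c : C) : (δ' * ε') (π' (f.toMulEquiv c)) = (δ * ε) (π c) :=
    h.additive.char_map h'.additive (f := f.toMulEquiv.toMonoidHom) f.toMulEquiv.injective hu c
  have hτ (c : C) : τ' (toCirc (π' (f.toMulEquiv c))) = τ (toCirc (π c)) :=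
    h.multiplicative.char_map h'.multiplicative
      (f := MonoidHom.mk' (circMap f.toMulEquiv) f.map_circ) f.toMulEquiv.injective hu (toCirc c)
  have g_circ (a b : B) : g (circ a b) = circ (g a) (g b) := by
    obtain ⟨c, rfl⟩ := h.additive.surjective a
    obtain ⟨d, rfl⟩ := h.additive.surjective b
    rw [← h.map_circ, hg, f.apply_circ, h'.map_circ, hg, hg]
  refine ⟨⟨g, g_circ⟩, ?_, ?_, ?_⟩ <;> rw [h.additive.surjective.forall] <;> intro c <;>
    simp only [hg, hε, hτ]
  exact mul_right_cancel ((congrArg _ (hε c).symm).trans (hδε c))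

end IsBraceExtension

namespace IsTwoSidedSemidirect

variable {p : ℕ} {C C' B B' : Type*} [SkewBrace C] [SkewBrace C'] [SkewBrace B] [SkewBrace B']
  {δ ε : B →* (ZMod p)ˣ} {τ : Circ B →* (ZMod p)ˣ} {δ' ε' : B' →* (ZMod p)ˣ}
  {τ' : Circ B' →* (ZMod p)ˣ}

theorem congr (h : IsTwoSidedSemidirect C δ ε τ) (g : Iso B B')
    (hδ : ∀ b, δ' (g.toMulEquiv b) = δ b) (hε : ∀ b, ε' (g.toMulEquiv b) = ε b)
    (hτ : ∀ b, τ' (toCirc (g.toMulEquiv b)) = τ (toCirc b)) : IsTwoSidedSemidirect C δ' ε' τ' := by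
  obtain ⟨e, hmul, hcirc⟩ := h
  refine ⟨e.trans ((Equiv.refl _).prodCongr g.toMulEquiv.toEquiv), fun x y => ?_, fun x y => ?_⟩
  · simp [hmul, hδ, hε]
  · simp [hcirc, hτ, g.apply_circ]

theorem nonempty_iso_of_eq (h : IsTwoSidedSemidirect C δ ε τ) (h' : IsTwoSidedSemidirect C' δ ε τ) :
    Nonempty (Iso C C') := by
  obtain ⟨e, hmul, hcirc⟩ := h
  obtain ⟨e', hmul', hcirc'⟩ := h'
  exact ⟨{ e.trans e'.symm with
    map_mul' := fun x y => e'.injective (by simp [hmul, hmul'])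
    map_circ := fun x y => e'.injective (by simp [hcirc, hcirc']) }⟩

theorem nonempty_iso_iff (hB : (Nat.card B).Coprime p)
    (hB' : (Nat.card B').Coprime p) (h : IsTwoSidedSemidirect C δ ε τ)
    (h' : IsTwoSidedSemidirect C' δ' ε' τ') :
    Nonempty (Iso C C') ↔ ∃ g : Iso B B', (∀ b, δ' (g.toMulEquiv b) = δ b) ∧
      (∀ b, ε' (g.toMulEquiv b) = ε b) ∧ ∀ b, τ' (toCirc (g.toMulEquiv b)) = τ (toCirc b) := by
  constructor
  · rintro ⟨f⟩
    obtain ⟨φ, π, hπ⟩ := h.exists_isBraceExtension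
    obtain ⟨φ', π', hπ'⟩ := h'.exists_isBraceExtension
    refine hπ.exists_iso hπ' f fun c => ?_
    rw [hπ.additive.map_eq_one_iff_pow hB, hπ'.additive.map_eq_one_iff_pow hB', ← map_pow,
      EmbeddingLike.map_eq_one_iff]
  · rintro ⟨g, hδ, hε, hτ⟩
    exact (h.congr g hδ hε hτ).nonempty_iso_of_eq h'

end IsTwoSidedSemidirect

end SkewBrace

namespace SkewBrace

/-- The set `R × G`, with the group law `(m, a) (n, b) = (ε(b)⁻¹ m + δ(a) n, a b)`. -/
@[ext]
structure TwoSidedProduct {R G : Type*} [CommRing R] [Group G] (δ ε : G →* Rˣ) where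
  base : R
  top : G

namespace TwoSidedProduct

section Group

variable {R G : Type*} [CommRing R] [Group G] {δ ε : G →* Rˣ}

instance : Mul (TwoSidedProduct δ ε) :=
  ⟨fun x y => ⟨↑(ε y.top)⁻¹ * x.base + δ x.top * y.base, x.top * y.top⟩⟩

instance : One (TwoSidedProduct δ ε) := ⟨⟨0, 1⟩⟩

instance : Inv (TwoSidedProduct δ ε) := ⟨fun x => ⟨-(ε x.top * ↑(δ x.top)⁻¹ * x.base), x.top⁻¹⟩⟩

theorem mul_def (x y : TwoSidedProduct δ ε) :
    x * y = ⟨↑(ε y.top)⁻¹ * x.base + δ x.top * y.base, x.top * y.top⟩ := rfl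

theorem one_def : (1 : TwoSidedProduct δ ε) = ⟨0, 1⟩ := rfl

theorem inv_def (x : TwoSidedProduct δ ε) :
    x⁻¹ = ⟨-(ε x.top * ↑(δ x.top)⁻¹ * x.base), x.top⁻¹⟩ := rfl

instance : Group (TwoSidedProduct δ ε) := Group.ofLeftAxioms
  (fun x y z => TwoSidedProduct.ext
    (by simp only [mul_def, map_mul, mul_inv, Units.val_mul]; ring) (mul_assoc _ _ _))
  (fun x => by simp [mul_def, one_def])
  (fun x => by simp [mul_def, one_def, inv_def, ← mul_assoc])

end Group

variable {p : ℕ} {B : Type*} [SkewBrace B] {δ ε : B →* (ZMod p)ˣ} {τ : Circ B →* (ZMod p)ˣ}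

/-- The identification of the two-sided products over the two groups of a skew brace. -/
def circEquiv (δ ε : B →* (ZMod p)ˣ) (τ : Circ B →* (ZMod p)ˣ) :
    TwoSidedProduct δ ε ≃ TwoSidedProduct τ 1 where
  toFun x := ⟨x.base, toCirc x.top⟩
  invFun x := ⟨x.base, toCirc.symm x.top⟩

/-- The skew brace with additive group `(m, a) · (n, b) = (ε(b)⁻¹ m + δ(a) n, a · b)` and
multiplicative group `(m, a) ∘ (n, b) = (m + τ(a) n, a ∘ b)`. -/
@[reducible]
def skewBrace (hδ : δ ∈ braceHom B p) (hε : ε ∈ braceHom B p)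
    (hδε : ∀ a b, (1 - δ a : ZMod p) * (1 - ε b) = 0) (τ : Circ B →* (ZMod p)ˣ) :
    SkewBrace (TwoSidedProduct δ ε) where
  circGroup := (circEquiv δ ε τ).group
  brace a b c := by
    have hmul (x y : TwoSidedProduct δ ε) : (circEquiv δ ε τ).group.mul x y =
        ⟨x.base + τ (toCirc x.top) * y.base, circ x.top y.top⟩ :=
      TwoSidedProduct.ext (by
        change ↑((1 : (ZMod p)ˣ)⁻¹) * x.base + τ (toCirc x.top) * y.base = _
        rw [inv_one, Units.val_one, one_mul]) rfl
    simp only [hmul]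
    refine TwoSidedProduct.ext ?_ (circ_mul _ _ _)
    simp only [mul_def, inv_def, map_mul, map_inv, mul_inv, inv_inv, hδ a.top, hε a.top,
      Units.val_mul]
    set α := a.base
    set β := b.base
    set γ := c.base
    set t : ZMod p := ↑(τ (toCirc a.top))
    set d : ZMod p := ↑(δ b.top)
    set e : ZMod p := ↑(ε c.top)⁻¹
    linear_combination (e * δ a.top * ↑(δ a.top)⁻¹ * d * α - e * (α + t * β)) * (ε a.top).inv_mul +
      (e * d * α - d * (α + t * γ)) * (δ a.top).mul_inv - α * e * hδε b.top c.top -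
      α * (1 - d) * (ε c.top).inv_mul

theorem exists_isTwoSidedSemidirect [NeZero p] {n : ℕ} (B : FinSkewBrace n) {δ ε : B →* (ZMod p)ˣ}
    (hδ : δ ∈ braceHom B p) (hε : ε ∈ braceHom B p)
    (hδε : ∀ a b, (1 - δ a : ZMod p) * (1 - ε b) = 0) (τ : Circ B →* (ZMod p)ˣ) :
    ∃ C : FinSkewBrace (n * p), IsTwoSidedSemidirect C δ ε τ := by
  let e : TwoSidedProduct δ ε ≃ ZMod p × B :=
    { toFun := fun x => (x.base, x.top), invFun := fun x => ⟨x.1, x.2⟩ }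
  let _ := skewBrace hδ hε hδε τ
  have := Finite.of_equiv _ e.symm
  refine ⟨⟨TwoSidedProduct δ ε, ?_⟩, e, fun x y => rfl, fun x y => Prod.ext ?_ rfl⟩
  · rw [Nat.card_congr e, Nat.card_prod, Nat.card_zmod, B.card_eq, mul_comm]
  · change ↑((1 : (ZMod p)ˣ)⁻¹) * x.base + τ (toCirc x.top) * y.base = _
    rw [inv_one, Units.val_one, one_mul]
    rfl

end TwoSidedProduct

end SkewBrace

theorem exists_zmod_bijection_of_card_eq_prime {p : ℕ} [Fact p.Prime] {G : Type*} [Group G]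
    {P : Subgroup G} (hP : Nat.card P = p) : ∃ φ : ZMod p → G, (∀ x y, φ (x + y) = φ x * φ y) ∧
      Function.Injective φ ∧ ∀ g, g ∈ P ↔ ∃ x, φ x = g := by
  let e : Multiplicative (ZMod p) ≃* P := mulEquivOfPrimeCardEq (p := p) (by simp) hP
  refine ⟨fun x => e (.ofAdd x), fun x y => by simp, ?_, fun g => ⟨fun hg => ?_, ?_⟩⟩
  · exact Subtype.val_injective.comp (e.injective.comp Multiplicative.ofAdd.injective)
  · exact ⟨(e.symm ⟨g, hg⟩).toAdd, by simp⟩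
  · rintro ⟨x, rfl⟩
    exact (e _).2

theorem le_of_coprime_card_index {G : Type*} [Group G] {H N : Subgroup G} [N.Normal]
    (h : (Nat.card H).Coprime N.index) : H ≤ N :=
  Subgroup.relIndex_eq_one.1 <| Nat.eq_one_of_dvd_coprimes h (Subgroup.relIndex_dvd_card N H)
    (Subgroup.relIndex_dvd_index_of_normal N H)

namespace SkewBrace

section Quotient

variable {C : Type*} [SkewBrace C] {P : Subgroup C}

theorem lam_mem_iff (hP : ∀ a, ∀ b ∈ P, lam a b ∈ P) {a b : C} : lam a b ∈ P ↔ b ∈ P := by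
  refine ⟨fun h => ?_, hP a b⟩
  have hinv : circ (toCirc.symm (toCirc a)⁻¹) a = 1 := by
    rw [← toCirc.injective.eq_iff, toCirc_circ, toCirc_one]
    exact inv_mul_cancel _
  rw [← lam_one_apply b, ← hinv, lam_circ]
  exact hP _ _ h

/-- A left ideal, i.e. a subgroup of `(C, ·)` stable under the maps `λ_a`, as a subgroup of
`(C, ∘)`. -/
def circSubgroup (P : Subgroup C) (hP : ∀ a, ∀ b ∈ P, lam a b ∈ P) : Subgroup (Circ C) where
  carrier := {a | toCirc.symm a ∈ P}
  one_mem' := by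
    change toCirc.symm 1 ∈ P
    rw [← toCirc_one]
    exact P.one_mem
  mul_mem' {a b} ha hb := by
    change circ (toCirc.symm a) (toCirc.symm b) ∈ P
    rw [circ_eq_mul_lam]
    exact P.mul_mem ha (hP _ _ hb)
  inv_mem' {a} ha := by
    have hmul : circ (toCirc.symm a) (toCirc.symm a⁻¹) = 1 :=
      (mul_inv_cancel a).trans toCirc_one.symm
    rw [circ_eq_mul_lam] at hmul
    change toCirc.symm a⁻¹ ∈ P
    rw [← lam_mem_iff hP, eq_inv_of_mul_eq_one_right hmul]
    exact P.inv_mem ha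

theorem inv_mul_mem_circSubgroup_iff (hP : ∀ a, ∀ b ∈ P, lam a b ∈ P) (a b : C) :
    (toCirc a)⁻¹ * toCirc b ∈ circSubgroup P hP ↔ a⁻¹ * b ∈ P := by
  have hb : circ a (toCirc.symm ((toCirc a)⁻¹ * toCirc b)) = b :=
    mul_inv_cancel_left (toCirc a) (toCirc b)
  conv_rhs => rw [← hb, ← lam_apply, lam_mem_iff hP]
  rfl

/-- The quotient of a skew brace by an ideal. -/
@[reducible]
def quotientBrace (P : Subgroup C) [P.Normal] (hP : ∀ a, ∀ b ∈ P, lam a b ∈ P)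
    [(circSubgroup P hP).Normal] : SkewBrace (C ⧸ P) where
  circGroup :=
    let e : C ⧸ P ≃ Circ C ⧸ circSubgroup P hP := Quotient.congr (ra := QuotientGroup.leftRel P)
      (rb := QuotientGroup.leftRel (circSubgroup P hP)) toCirc fun a b => by
        rw [QuotientGroup.leftRel_apply, QuotientGroup.leftRel_apply,
          inv_mul_mem_circSubgroup_iff]
    e.group
  brace a b c := by
    induction a using QuotientGroup.induction_on with | H a => ?_
    induction b using QuotientGroup.induction_on with | H b => ?_
    induction c using QuotientGroup.induction_on with | H c => ?_
    exact congrArg (QuotientGroup.mk (s := P)) (circ_mul a b c)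

theorem lam_mem_of_coprime_card_index [P.Normal] (hP : (Nat.card P).Coprime P.index) (a : C) {b : C}
    (hb : b ∈ P) : lam a b ∈ P := by
  have hmap : P.map (lam a) ≤ P := le_of_coprime_card_index <|
    hP.coprime_dvd_left (Subgroup.card_map_dvd P (lam a))
  exact hmap (Subgroup.mem_map_of_mem _ hb)

theorem circSubgroup_normal_of_coprime_card_index [Finite C] (hP : ∀ a, ∀ b ∈ P, lam a b ∈ P)
    (hcop : (Nat.card P).Coprime P.index) {P' : Subgroup (Circ C)} [hn : P'.Normal]
    (hP' : Nat.card P' = Nat.card P) : (circSubgroup P hP).Normal := by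
  have hindex : P'.index = P.index := by
    refine Nat.eq_of_mul_eq_mul_left (Nat.card_pos (α := P)) ?_
    rw [P.card_mul_index, ← hP', P'.card_mul_index]
    rfl
  have hle : circSubgroup P hP ≤ P' := le_of_coprime_card_index (hindex.symm ▸ hcop)
  have : Finite (Circ C) := ‹Finite C›
  rwa [Subgroup.eq_of_le_of_card_ge hle hP'.le]

end Quotient

theorem exists_isScalarExtension_of_card_ker {p : ℕ} [Fact p.Prime] {C B : Type*} [SkewBrace C]
    [SkewBrace B] {π : C →* B} (hcirc : ∀ c d, π (circ c d) = circ (π c) (π d))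
    (hπ : Function.Surjective π) (hcard : Nat.card π.ker = p) :
    ∃ (φ : ZMod p → C) (σ : B →* (ZMod p)ˣ) (τ : Circ B →* (ZMod p)ˣ),
      IsScalarExtension φ π σ ∧ IsScalarExtension (fun x => toCirc (φ x)) (circMap π) τ := by
  obtain ⟨φ, hadd, hφ, hrange⟩ := exists_zmod_bijection_of_card_eq_prime hcard
  obtain ⟨σ, hσ⟩ := IsScalarExtension.exists_char hadd hφ hπ hrange
  obtain ⟨l, hl⟩ := exists_lamChar hσ hcirc
  let π' : Circ C →* Circ B := MonoidHom.mk' (circMap π) hcirc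
  have hrange' (c : Circ C) : π' c = 1 ↔ ∃ x, toCirc (φ x) = c := by
    rw [← toCirc_one]
    exact hrange (toCirc.symm c)
  have hpow (x : ZMod p) : toCirc (φ x) ^ p = 1 := by
    have hker : Nat.card π'.ker = p := by
      rw [← hcard]
      exact Nat.card_congr (Equiv.subtypeEquivRight fun c => (hrange' c).trans (hrange c).symm)
    have := pow_card_eq_one' (x := (⟨toCirc (φ x), (hrange' _).2 ⟨x, rfl⟩⟩ : π'.ker))
    rw [hker] at this
    exact congrArg Subtype.val this
  obtain ⟨τ, hτ⟩ := IsScalarExtension.exists_char (φ := fun x => toCirc (φ x)) (π := π')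
    (fun x y => by
      rw [← toCirc_circ, circ_eq_mul_lam, hl, units_hom_eq_one_of_pow_eq_one l (hpow x),
        Units.val_one, one_mul, hadd])
    (toCirc.injective.comp hφ) hπ hrange'
  exact ⟨φ, σ, τ, hσ, hτ⟩

theorem exists_isTwoSidedSemidirect_of_normal {n p : ℕ} [Fact p.Prime] (hnp : n.Coprime p)
    (C : FinSkewBrace (n * p)) (P : Subgroup C) [P.Normal] (hP : Nat.card P = p)
    (P' : Subgroup (Circ C)) [P'.Normal] (hP' : Nat.card P' = p) :
    ∃ (B : FinSkewBrace n) (σ : B →* (ZMod p)ˣ) (τ : Circ B →* (ZMod p)ˣ),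
      IsTwoSidedSemidirect C σ 1 τ ∨ IsTwoSidedSemidirect C 1 σ τ := by
  have hindex : P.index = n := by
    have := P.index_mul_card
    rw [C.card_eq, hP] at this
    exact Nat.eq_of_mul_eq_mul_right (NeZero.pos p) this
  have hcop : (Nat.card P).Coprime P.index := by rw [hP, hindex]; exact hnp.symm
  have hlam (a : C) : ∀ b ∈ P, lam a b ∈ P := fun b => lam_mem_of_coprime_card_index hcop a
  have := circSubgroup_normal_of_coprime_card_index hlam hcop (hP'.trans hP.symm)
  let _ := quotientBrace P hlam
  have hker : Nat.card (QuotientGroup.mk' P).ker = p := by rw [QuotientGroup.ker_mk', hP]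
  obtain ⟨φ, σ, τ, hσ, hτ⟩ := exists_isScalarExtension_of_card_ker (π := QuotientGroup.mk' P)
    (fun _ _ => rfl) (QuotientGroup.mk'_surjective P) hker
  have hunit : IsUnit (Nat.card (C ⧸ P) : ZMod p) := by
    rw [← Subgroup.index_eq_card, hindex]
    exact (ZMod.isUnit_iff_coprime n p).2 hnp
  exact ⟨⟨C ⧸ P, hindex⟩, σ, τ, (IsBraceExtension.of_isScalarExtension hunit hσ hτ).imp
    (·.isTwoSidedSemidirect hunit) (·.isTwoSidedSemidirect hunit)⟩

end SkewBrace

section Burnside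

open MulAction

theorem finsum_card_sep_comm {X Y : Type*} {S : Set X} {T : Set Y} (hS : S.Finite) (hT : T.Finite)
    (r : X → Y → Prop) :
    ∑ᶠ x ∈ S, (Nat.card {y | y ∈ T ∧ r x y} : ℚ) =
      ∑ᶠ y ∈ T, (Nat.card {x | x ∈ S ∧ r x y} : ℚ) := by
  classical
  lift S to Finset X using hS
  lift T to Finset Y using hT
  rw [finsum_mem_coe_finset, finsum_mem_coe_finset]
  have := Finset.sum_card_bipartiteAbove_eq_sum_card_bipartiteBelow r (s := S) (t := T)
  convert congrArg (Nat.cast : ℕ → ℚ) this using 1 <;> push_cast <;> congr! 2 <;>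
    exact Nat.subtype_card _ (by simp [Finset.bipartiteAbove, Finset.bipartiteBelow])

theorem card_orbits_eq_finsum_card_stabilizer {G X : Type*} [Group G] [MulAction G X] [Finite G]
    [Finite X] :
    (Nat.card (orbitRel.Quotient G X) : ℚ) =
      1 / (Nat.card G : ℚ) * ∑ᶠ x : X, (Nat.card (stabilizer G x) : ℚ) := by
  have := Fintype.ofFinite X
  have h : Nat.card (orbitRel.Quotient G X) * Nat.card G = ∑ x : X, Nat.card (stabilizer G x) := by
    rw [← Nat.card_prod, ← Nat.card_sigma]
    exact Nat.card_congr ((sigmaFixedByEquivOrbitsProdGroup G X).symm.trans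
      ⟨fun x => ⟨x.2.1, x.1, x.2.2⟩, fun x => ⟨x.2.1, x.1, x.2.2⟩, fun _ => rfl, fun _ => rfl⟩)
  rw [finsum_eq_sum_of_fintype, ← Nat.cast_sum, ← h, Nat.cast_mul]
  have : (Nat.card G : ℚ) ≠ 0 := Nat.cast_ne_zero.2 Nat.card_pos.ne'
  field_simp

theorem ncard_range_eq_card_orbits {G X Y : Type*} [Group G] [MulAction G X] {f : X → Y}
    (hf : ∀ x y, f x = f y ↔ ∃ g : G, g • x = y) :
    (Set.range f).ncard = Nat.card (orbitRel.Quotient G X) := by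
  have : orbitRel G X = Setoid.ker f := Setoid.ext fun x y => by
    rw [Setoid.ker_def, eq_comm, hf]
    rfl
  exact Nat.card_congr ((Setoid.quotientKerEquivRange f).symm.trans
    (Quotient.congrRight fun x y => by rw [this]))

theorem ncard_range_of_precomp {G X Y β M : Type*} [Group G] [MulAction G β] [Finite X]
    (K : Subgroup G) [Finite K] {ev : X → β → M} (hev : Function.Injective ev)
    (hK : ∀ g ∈ K, ∀ x, ∃ y, ∀ b, ev y b = ev x (g • b)) {f : X → Y}
    (hf : ∀ x y, f x = f y ↔ ∃ g ∈ K, ∀ b, ev y (g • b) = ev x b) :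
    ((Set.range f).ncard : ℚ) = 1 / (Nat.card K : ℚ) *
      ∑ᶠ x, (Nat.card {g | g ∈ K ∧ ∀ b, ev x (g • b) = ev x b} : ℚ) := by
  choose act hact using fun g : K => hK g g.2
  let _ : SMul Kᵈᵐᵃ X := ⟨fun g => act (DomMulAct.mk.symm g)⟩
  let _ : MulAction Kᵈᵐᵃ X := hev.mulAction ev fun g x => funext (hact _ x)
  have : Finite Kᵈᵐᵃ := Finite.of_equiv K DomMulAct.mk
  have smul_eq_iff (g : K) (x y : X) : DomMulAct.mk g • x = y ↔ ∀ b, ev x (g • b) = ev y b := by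
    rw [← hev.eq_iff, funext_iff]
    exact forall_congr' fun b => Eq.congr_left (hact g x b)
  have hf' (x y : X) : f x = f y ↔ ∃ g : Kᵈᵐᵃ, g • x = y := by
    rw [eq_comm, hf, (DomMulAct.mk (M := K)).surjective.exists]
    simp only [smul_eq_iff, Subtype.exists, Subgroup.mk_smul, exists_prop]
  rw [ncard_range_eq_card_orbits hf', card_orbits_eq_finsum_card_stabilizer,
    Nat.card_congr DomMulAct.mk.symm]
  congr! 4 with x
  exact Nat.card_congr ⟨
    fun ⟨g, hg⟩ => ⟨(DomMulAct.mk (M := K)).symm g, Subtype.prop _, (smul_eq_iff _ _ _).1 hg⟩,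
    fun g => ⟨DomMulAct.mk ⟨g, g.2.1⟩, (smul_eq_iff _ _ _).2 g.2.2⟩, fun _ => rfl, fun _ => rfl⟩

end Burnside

instance finite_monoidHom {G H : Type*} [Group G] [Group H] [Finite G] [Finite H] :
    Finite (G →* H) := DFunLike.finite _

namespace SkewBrace

section Automorphisms

variable {p : ℕ} {A B : Type*} [SkewBrace A] [SkewBrace B]

instance finite_circ [Finite B] : Finite (Circ B) := ‹Finite B›

theorem one_mem_braceHom : (1 : B →* (ZMod p)ˣ) ∈ braceHom B p := fun _ _ => (mul_one 1).symm

theorem comp_mem_braceHom {σ : B →* (ZMod p)ˣ} (hσ : σ ∈ braceHom B p) {f : A →* B}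
    (hf : ∀ a b, f (circ a b) = circ (f a) (f b)) : σ.comp f ∈ braceHom A p := fun a b =>
  (congrArg σ (hf a b)).trans (hσ _ _)

theorem exists_iso_iff_exists_mem_autBrace {P : MulAut B → Prop} :
    (∃ g : Iso B B, P g.toMulEquiv) ↔ ∃ g ∈ autBrace B, P g :=
  ⟨fun ⟨g, h⟩ => ⟨g.toMulEquiv, g.map_circ, h⟩, fun ⟨g, hg, h⟩ => ⟨⟨g, hg⟩, h⟩⟩

theorem stabDot_one : stabDot (1 : B →* (ZMod p)ˣ) = ⊤ := eq_top_iff.2 fun _ _ _ => rfl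

theorem autStab_one : autStab (1 : B →* (ZMod p)ˣ) = autBrace B := by
  rw [autStab, stabDot_one, inf_top_eq]

theorem IsOrbitReps.one_mem {R : Set (B →* (ZMod p)ˣ)} (hR : IsOrbitReps R) : 1 ∈ R := by
  obtain ⟨r, ⟨hr, g, -, hg⟩, -⟩ := hR.2 1 one_mem_braceHom
  rwa [show r = 1 from MonoidHom.ext fun b => (hg b).symm] at hr

theorem IsOrbitReps.eq_of_iso {R : Set (B →* (ZMod p)ˣ)} (hR : IsOrbitReps R)
    {r s : B →* (ZMod p)ˣ} (hr : r ∈ R) (hs : s ∈ R) (g : Iso B B)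
    (hg : ∀ b, r (g.toMulEquiv b) = s b) : r = s :=
  (hR.2 r (hR.1 hr)).unique ⟨hr, 1, (autBrace B).one_mem, fun _ => rfl⟩
    ⟨hs, g.toMulEquiv, g.map_circ, hg⟩

theorem ncard_range_braceHom [Finite B] {Y : Type*} {f : braceHom B p → Y}
    (hf : ∀ σ σ', f σ = f σ' ↔ ∃ g : Iso B B, ∀ b, σ'.1 (g.toMulEquiv b) = σ.1 b) :
    ((Set.range f).ncard : ℚ) = 1 / (Nat.card (autBrace B) : ℚ) *
      ∑ᶠ σ ∈ braceHom B p, (Nat.card ↥(autBrace B ⊓ stabDot σ) : ℚ) := by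
  rw [ncard_range_of_precomp (autBrace B) (ev := fun σ : braceHom B p => ⇑σ.1)
    (DFunLike.coe_injective.comp Subtype.val_injective)
    (fun g hg σ => ⟨⟨_, comp_mem_braceHom σ.2 (f := g.toMonoidHom) hg⟩, fun _ => rfl⟩)
    fun σ σ' => (hf σ σ').trans
      (exists_iso_iff_exists_mem_autBrace (P := fun g => ∀ b, σ'.1 (g b) = σ.1 b))]
  exact congrArg _ (finsum_set_coe_eq_finsum_mem (braceHom B p)
    (f := fun σ => (Nat.card ↥(autBrace B ⊓ stabDot σ) : ℚ)))

theorem ncard_range_circHom [Finite B] {K : Subgroup (MulAut B)} (hK : K ≤ autBrace B)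
    {Y : Type*} {f : (Circ B →* (ZMod p)ˣ) → Y}
    (hf : ∀ τ τ', f τ = f τ' ↔ ∃ g ∈ K, ∀ b, τ' (toCirc (g b)) = τ (toCirc b)) :
    ((Set.range f).ncard : ℚ) = 1 / (Nat.card K : ℚ) *
      ∑ᶠ τ : Circ B →* (ZMod p)ˣ, (Nat.card ↥(K ⊓ stabCirc τ) : ℚ) :=
  ncard_range_of_precomp K (ev := fun (τ : Circ B →* (ZMod p)ˣ) (b : B) => τ (toCirc b))
    (fun _ _ h => MonoidHom.ext (congrFun h))
    (fun g hg τ => ⟨τ.comp (MonoidHom.mk' (circMap g) (hK hg)), fun _ => rfl⟩) hf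

theorem finsum_card_stabDot_eq_finsum_card_fixBraceHom [Finite B] :
    ∑ᶠ σ ∈ braceHom B p, (Nat.card ↥(autBrace B ⊓ stabDot σ) : ℚ) =
      ∑ᶠ g ∈ autBrace B, (Nat.card (fixBraceHom p g) : ℚ) :=
  finsum_card_sep_comm (Set.toFinite _) (Set.toFinite (autBrace B : Set (MulAut B)))
    fun (σ : B →* (ZMod p)ˣ) g => ∀ b, σ (g b) = σ b

theorem finsum_card_stabCirc_eq_finsum_card_fixCircHom [Finite B]
    (K : Subgroup (MulAut B)) :
    ∑ᶠ τ : Circ B →* (ZMod p)ˣ, (Nat.card ↥(K ⊓ stabCirc τ) : ℚ) =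
      ∑ᶠ g ∈ K, (Nat.card (fixCircHom p g) : ℚ) := by
  have := finsum_card_sep_comm Set.finite_univ (Set.toFinite (K : Set (MulAut B)))
    fun (τ : Circ B →* (ZMod p)ˣ) g => ∀ b, τ (toCirc (g b)) = τ (toCirc b)
  rw [finsum_mem_univ] at this
  simp only [Set.mem_univ, true_and] at this
  exact this

end Automorphisms

end SkewBrace

theorem card_eq_sum_ncard_of_existsUnique {X Y : Type*} [Fintype Y] {S : Y → Set X}
    (hS : ∀ x, ∃! y, x ∈ S y) (hfin : ∀ y, (S y).Finite) : Nat.card X = ∑ y, (S y).ncard := by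
  have (y : Y) : Finite (S y) := (hfin y).to_subtype
  choose f hf hf' using hS
  have h (x : X) (y : Y) : f x = y ↔ x ∈ S y := ⟨fun h => h ▸ hf x, fun h => (hf' x y h).symm⟩
  rw [Nat.card_congr (Equiv.sigmaFiberEquiv f).symm,
    Nat.card_congr (Equiv.sigmaCongrRight fun y => Equiv.subtypeEquivRight fun x => h x y),
    Nat.card_sigma]
  rfl

namespace FinSkewBrace

instance finite_quotient (m : ℕ) : Finite (Quotient (isoSetoid m)) := by
  let e (C : FinSkewBrace m) : C ≃ Fin m := Finite.equivFinOfCardEq C.card_eq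
  let table (C : FinSkewBrace m) (i j : Fin m) : Fin m × Fin m :=
    (e C ((e C).symm i * (e C).symm j), e C (circ ((e C).symm i) ((e C).symm j)))
  refine Finite.of_injective (fun q : Quotient (isoSetoid m) => table q.out) fun q q' h => ?_
  have h (x y : q.out.carrier) := congrFun (congrFun h (e _ x)) (e _ y)
  simp only [table, Equiv.symm_apply_apply, Prod.mk.injEq] at h
  refine Quotient.out_equiv_out.1 ⟨{ (e q.out).trans (e q'.out).symm with
    map_mul' := fun x y => (Equiv.symm_apply_eq _).2 (h x y).1
    map_circ := fun x y => (Equiv.symm_apply_eq _).2 (h x y).2 }⟩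

/-- The set of isomorphism classes of skew braces of size `m` with the property `P`. -/
def classes (m : ℕ) (P : FinSkewBrace m → Prop) : Set (Quotient (isoSetoid m)) :=
  {q | ∃ C : FinSkewBrace m, P C ∧ Quotient.mk _ C = q}

theorem countWith_eq_ncard_classes (m : ℕ) (P : FinSkewBrace m → Prop) :
    countWith m P = (classes m P).ncard := rfl

theorem mk_mem_classes {m : ℕ} {P : FinSkewBrace m → Prop}
    (hP : ∀ C D : FinSkewBrace m, Iso C D → P C → P D) (C : FinSkewBrace m) :
    Quotient.mk (isoSetoid m) C ∈ classes m P ↔ P C := by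
  refine ⟨?_, fun h => ⟨C, h, rfl⟩⟩
  rintro ⟨D, hD, h⟩
  obtain ⟨f⟩ := Quotient.exact h
  exact hP D C f hD

theorem countWith_or {m : ℕ} {P Q : FinSkewBrace m → Prop}
    (hQ : ∀ C D : FinSkewBrace m, Iso C D → Q C → Q D) (h : ∀ C, ¬ (P C ∧ Q C)) :
    countWith m (fun C => P C ∨ Q C) = countWith m P + countWith m Q := by
  simp only [countWith_eq_ncard_classes]
  rw [← Set.ncard_union_eq (Set.disjoint_left.2 ?_)]
  · simp only [classes, or_and_right, exists_or]
    rfl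
  · rintro _ ⟨C, hP, rfl⟩ hC
    exact h C ⟨hP, (mk_mem_classes hQ C).1 hC⟩

theorem count_eq_sum_countWith {m : ℕ} {Y : Type*} [Fintype Y] {P : Y → FinSkewBrace m → Prop}
    (hP : ∀ y, ∀ C D : FinSkewBrace m, Iso C D → P y C → P y D) (h : ∀ C, ∃! y, P y C) :
    count m = ∑ y, countWith m (P y) :=
  card_eq_sum_ncard_of_existsUnique (S := fun y => classes m (P y))
    (Quotient.ind fun C => by simpa only [mk_mem_classes (hP _)] using h C) fun _ => Set.toFinite _

theorem IsReps.eq_of_iso {n : ℕ} {ι : Type} {B : ι → FinSkewBrace n} (hB : IsReps B) {i j : ι}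
    (g : Iso (B i) (B j)) : i = j := (hB (B i)).unique ⟨Iso.refl _⟩ ⟨g⟩

end FinSkewBrace

section Classification

variable {n p : ℕ}

theorem SkewBrace.IsTwoSidedSemidirect.of_iso {C D B : Type*} [SkewBrace C] [SkewBrace D]
    [SkewBrace B] {δ ε : B →* (ZMod p)ˣ} {τ : Circ B →* (ZMod p)ˣ}
    (h : IsTwoSidedSemidirect C δ ε τ) (f : Iso C D) : IsTwoSidedSemidirect D δ ε τ := by
  obtain ⟨e, hmul, hcirc⟩ := h
  refine ⟨f.toMulEquiv.symm.toEquiv.trans e, fun x y => ?_, fun x y => ?_⟩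
  · simp [hmul]
  · exact (congrArg e (f.symm.map_circ x y)).trans (hcirc _ _)

section

variable {C B B' : Type*} [SkewBrace C] [SkewBrace B] [SkewBrace B'] {σ : B →* (ZMod p)ˣ}
  {τ : Circ B →* (ZMod p)ˣ}

theorem isMirrorDoubleSemidirect_one_iff :
    IsMirrorDoubleSemidirect C (1 : B →* (ZMod p)ˣ) τ ↔
      IsDoubleSemidirect C (1 : B →* (ZMod p)ˣ) τ := by
  rw [← isTwoSidedSemidirect_one_left, isTwoSidedSemidirect_one_right]

theorem eq_one_of_isDoubleSemidirect_of_isMirrorDoubleSemidirect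
    (hB : (Nat.card B).Coprime p) {τ' : Circ B →* (ZMod p)ˣ} (h : IsDoubleSemidirect C σ τ)
    (h' : IsMirrorDoubleSemidirect C σ τ') : σ = 1 := by
  rw [← isTwoSidedSemidirect_one_right] at h
  rw [← isTwoSidedSemidirect_one_left] at h'
  obtain ⟨g, hσ, -⟩ := (h.nonempty_iso_iff hB hB h').1 ⟨Iso.refl C⟩
  exact MonoidHom.ext fun b => (hσ b).symm

theorem exists_iso_of_isDoubleSemidirect_or (hB : (Nat.card B).Coprime p)
    (hB' : (Nat.card B').Coprime p) {σ' : B' →* (ZMod p)ˣ} {τ' : Circ B' →* (ZMod p)ˣ}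
    (h : IsDoubleSemidirect C σ τ ∨ IsMirrorDoubleSemidirect C σ τ)
    (h' : IsDoubleSemidirect C σ' τ' ∨ IsMirrorDoubleSemidirect C σ' τ') :
    ∃ g : Iso B B', ∀ b, σ' (g.toMulEquiv b) = σ b := by
  simp only [← isTwoSidedSemidirect_one_right, ← isTwoSidedSemidirect_one_left] at h h'
  rcases h with h | h <;> rcases h' with h' | h' <;>
    obtain ⟨g, hl, hr, -⟩ := (h.nonempty_iso_iff hB hB' h').1 ⟨Iso.refl C⟩ <;>
    exact ⟨g, fun b => by
      simpa only [MonoidHom.one_apply, mul_one, one_mul] using congrArg₂ (· * ·) (hl b) (hr b)⟩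

end

theorem countWith_isTwoSidedSemidirect [NeZero p] (hnp : n.Coprime p) (B : FinSkewBrace n)
    {δ ε : B →* (ZMod p)ˣ} (hδ : δ ∈ braceHom B p) (hε : ε ∈ braceHom B p)
    (hδε : ∀ a b, (1 - δ a : ZMod p) * (1 - ε b) = 0) :
    (countWith (n * p) (fun C => ∃ τ, IsTwoSidedSemidirect C δ ε τ) : ℚ) =
      1 / (Nat.card ↥(autStab δ ⊓ stabDot ε) : ℚ) *
        ∑ᶠ τ : Circ B →* (ZMod p)ˣ, (Nat.card ↥(autStab δ ⊓ stabDot ε ⊓ stabCirc τ) : ℚ) := by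
  have hB : (Nat.card B).Coprime p := by rwa [B.card_eq]
  choose C hC using TwoSidedProduct.exists_isTwoSidedSemidirect B hδ hε hδε
  let f (τ : Circ B →* (ZMod p)ˣ) : Quotient (isoSetoid (n * p)) := Quotient.mk _ (C τ)
  have hrange : classes (n * p) (fun C => ∃ τ, IsTwoSidedSemidirect C δ ε τ) = Set.range f := by
    ext q
    constructor
    · rintro ⟨D, ⟨τ, hD⟩, rfl⟩
      exact ⟨τ, Quotient.sound ((hC τ).nonempty_iso_of_eq hD)⟩
    · rintro ⟨τ, rfl⟩
      exact ⟨C τ, ⟨τ, hC τ⟩, rfl⟩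
  rw [countWith_eq_ncard_classes, hrange]
  refine ncard_range_circHom (inf_le_left.trans inf_le_left) fun τ τ' => ?_
  refine Quotient.eq.trans (((hC τ).nonempty_iso_iff hB hB (hC τ')).trans ?_)
  refine exists_iso_iff_exists_mem_autBrace (P := fun g => (∀ b, δ (g b) = δ b) ∧
    (∀ b, ε (g b) = ε b) ∧ ∀ b, τ' (toCirc (g b)) = τ (toCirc b)) |>.trans ?_
  exact exists_congr fun g => by
    rw [← and_assoc, ← and_assoc]
    rfl

variable {B : FinSkewBrace n} {σ : B →* (ZMod p)ˣ}

theorem countWith_isDoubleSemidirect [NeZero p] (hnp : n.Coprime p) (hσ : σ ∈ braceHom B p) :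
    (countWith (n * p) (fun C => ∃ τ, IsDoubleSemidirect C σ τ) : ℚ) =
      1 / (Nat.card (autStab σ) : ℚ) *
        ∑ᶠ τ : Circ B →* (ZMod p)ˣ, (Nat.card ↥(autStab σ ⊓ stabCirc τ) : ℚ) := by
  have := countWith_isTwoSidedSemidirect hnp B hσ one_mem_braceHom (by simp)
  simpa only [isTwoSidedSemidirect_one_right, stabDot_one, inf_top_eq] using this

theorem countWith_isMirrorDoubleSemidirect [NeZero p] (hnp : n.Coprime p)
    (hσ : σ ∈ braceHom B p) :
    (countWith (n * p) (fun C => ∃ τ, IsMirrorDoubleSemidirect C σ τ) : ℚ) =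
      1 / (Nat.card (autStab σ) : ℚ) *
        ∑ᶠ τ : Circ B →* (ZMod p)ˣ, (Nat.card ↥(autStab σ ⊓ stabCirc τ) : ℚ) := by
  have := countWith_isTwoSidedSemidirect hnp B one_mem_braceHom hσ (by simp)
  simpa only [isTwoSidedSemidirect_one_left, autStab_one, ← autStab.eq_1 σ] using this

variable {ι : Type} {B : ι → FinSkewBrace n} {R : ∀ i, Set (B i →* (ZMod p)ˣ)}

theorem exists_iso_mem_orbitReps (hB : IsReps B) (hR : ∀ i, IsOrbitReps (R i))
    (B' : FinSkewBrace n) {σ : B' →* (ZMod p)ˣ} (hσ : σ ∈ braceHom B' p) :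
    ∃ i, ∃ r ∈ R i, ∃ g : Iso B' (B i), ∀ b, r (g.toMulEquiv b) = σ b := by
  obtain ⟨i, ⟨g⟩, -⟩ := hB B'
  obtain ⟨r, ⟨hr, h, hh, hhr⟩, -⟩ := (hR i).2 (σ.comp g.toMulEquiv.symm.toMonoidHom)
    (comp_mem_braceHom hσ g.symm.map_circ)
  refine ⟨i, r, hr, g.trans (Iso.symm ⟨h, hh⟩), fun b => ?_⟩
  have := hhr (h.symm (g.toMulEquiv b))
  rw [MulEquiv.apply_symm_apply] at this
  exact this.symm.trans (congrArg σ (g.toMulEquiv.symm_apply_apply b))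

theorem existsUnique_isDoubleSemidirect_or (hp : p.Prime) (hnp : n.Coprime p)
    (hG : ∀ (G : Type) [Group G], Nat.card G = n * p →
      ∃ P : Subgroup G, P.Normal ∧ Nat.card P = p)
    (hB : IsReps B) (hR : ∀ i, IsOrbitReps (R i)) (C : FinSkewBrace (n * p)) :
    ∃! q : Σ i, R i, ∃ τ, IsDoubleSemidirect C q.2.1 τ ∨ IsMirrorDoubleSemidirect C q.2.1 τ := by
  have := Fact.mk hp
  have hcop (i : ι) : (Nat.card (B i)).Coprime p := by rwa [(B i).card_eq]
  refine existsUnique_of_exists_of_unique ?_ ?_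
  · obtain ⟨P, _, hP⟩ := hG C C.card_eq
    obtain ⟨P', _, hP'⟩ := hG (Circ C) C.card_eq
    obtain ⟨B', σ, τ, h⟩ := exists_isTwoSidedSemidirect_of_normal hnp C P hP P' hP'
    have hσ : σ ∈ braceHom B' p := by
      rcases h with h | h <;> obtain ⟨φ, π, hE⟩ := h.exists_isBraceExtension
      exacts [hE.left_mem_braceHom, hE.right_mem_braceHom]
    obtain ⟨i, r, hr, g, hg⟩ := exists_iso_mem_orbitReps hB hR B' hσ
    let τ' := τ.comp (MonoidHom.mk' (circMap g.toMulEquiv.symm) g.symm.map_circ)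
    have hτ' (b : B') : τ' (toCirc (g.toMulEquiv b)) = τ (toCirc b) :=
      congrArg (fun b => τ (toCirc b)) (g.toMulEquiv.symm_apply_apply b)
    exact ⟨⟨i, r, hr⟩, τ', h.imp
      (fun h => isTwoSidedSemidirect_one_right.1 (h.congr g hg (fun _ => rfl) hτ'))
      (fun h => isTwoSidedSemidirect_one_left.1 (h.congr g (fun _ => rfl) hg hτ'))⟩
  · rintro ⟨i, r, hr⟩ ⟨j, s, hs⟩ ⟨τ, h⟩ ⟨τ', h'⟩
    obtain ⟨g, hg⟩ := exists_iso_of_isDoubleSemidirect_or (hcop i) (hcop j) h h'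
    obtain rfl := hB.eq_of_iso g
    obtain rfl := (hR i).eq_of_iso hs hr g hg
    rfl

theorem countWith_isDoubleSemidirect_or [NeZero p] (hnp : n.Coprime p) {B : FinSkewBrace n}
    {σ : B →* (ZMod p)ˣ} (hσ : σ ∈ braceHom B p) (hσ1 : σ ≠ 1) :
    (countWith (n * p)
      (fun C => ∃ τ, IsDoubleSemidirect C σ τ ∨ IsMirrorDoubleSemidirect C σ τ) : ℚ) =
      2 * countWith (n * p) (fun C => ∃ τ, IsDoubleSemidirect C σ τ) := by
  simp only [exists_or]
  rw [countWith_or, Nat.cast_add, countWith_isMirrorDoubleSemidirect hnp hσ,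
    ← countWith_isDoubleSemidirect hnp hσ, two_mul]
  · simp only [← isTwoSidedSemidirect_one_left]
    exact fun C D f ⟨τ, h⟩ => ⟨τ, h.of_iso f⟩
  · rintro C ⟨⟨τ, h⟩, τ', h'⟩
    exact hσ1 (eq_one_of_isDoubleSemidirect_of_isMirrorDoubleSemidirect (by rwa [B.card_eq]) h h')

theorem count_mul_eq_sum [Fintype ι] (hp : p.Prime) (hnp : n.Coprime p)
    (hG : ∀ (G : Type) [Group G], Nat.card G = n * p →
      ∃ P : Subgroup G, P.Normal ∧ Nat.card P = p)
    (hB : IsReps B) (hR : ∀ i, IsOrbitReps (R i)) :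
    (FinSkewBrace.count (n * p) : ℚ) =
      ∑ i, ((countWith (n * p) (fun C => ∃ τ, IsDoubleSemidirect C (1 : B i →* (ZMod p)ˣ) τ) : ℚ) +
        2 * ∑ᶠ σ ∈ R i \ {1},
          (countWith (n * p) (fun C => ∃ τ, IsDoubleSemidirect C σ τ) : ℚ)) := by
  have := NeZero.mk hp.ne_zero
  have := fun i => Fintype.ofFinite (R i)
  rw [count_eq_sum_countWith (Y := Σ i, R i) (fun q C D f ⟨τ, h⟩ => ⟨τ, ?_⟩)
    (existsUnique_isDoubleSemidirect_or hp hnp hG hB hR), Fintype.sum_sigma, Nat.cast_sum]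
  swap
  · simp only [← isTwoSidedSemidirect_one_left, ← isTwoSidedSemidirect_one_right] at h ⊢
    exact h.imp (·.of_iso f) (·.of_iso f)
  refine Finset.sum_congr rfl fun i _ => ?_
  let kinds (σ : B i →* (ZMod p)ˣ) : ℚ := countWith (n * p)
    (fun C => ∃ τ, IsDoubleSemidirect C σ τ ∨ IsMirrorDoubleSemidirect C σ τ)
  have hR1 : insert 1 (R i \ {1}) = R i := by
    rw [Set.insert_sdiff_singleton, Set.insert_eq_of_mem (hR i).one_mem]
  calc _ = ∑ᶠ σ ∈ R i, kinds σ := by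
        rw [Nat.cast_sum, ← finsum_set_coe_eq_finsum_mem, finsum_eq_sum_of_fintype]
    _ = kinds 1 + ∑ᶠ σ ∈ R i \ {1}, kinds σ := by
        rw [← finsum_mem_insert _ (by simp) (Set.toFinite _), hR1]
    _ = _ := by
        rw [mul_finsum_mem]
        refine congrArg₂ (· + ·) (by simp only [kinds, isMirrorDoubleSemidirect_one_iff, or_self])
          (finsum_mem_congr rfl fun σ hσ => ?_)
        exact countWith_isDoubleSemidirect_or hnp ((hR i).1 hσ.1) hσ.2

theorem npAdditiveStructure_count_eq_sum [NeZero p] [Fintype ι] (hB : IsReps B) :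
    (NpAdditiveStructure.count n p : ℚ) = ∑ i, 1 / (Nat.card (autBrace (B i)) : ℚ) *
      ∑ᶠ σ ∈ braceHom (B i) p, (Nat.card ↥(autBrace (B i) ⊓ stabDot σ) : ℚ) := by
  have realized (i) (σ : braceHom (B i) p) :
      ∃ C : FinSkewBrace (n * p), HasAdditiveStructure C σ.1 := by
    obtain ⟨C, hC⟩ := TwoSidedProduct.exists_isTwoSidedSemidirect (B i) σ.2 one_mem_braceHom
      (by simp) 1
    exact ⟨C, hasAdditiveStructure_of_isDoubleSemidirect (isTwoSidedSemidirect_one_right.1 hC)⟩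
  let f (i) (σ : braceHom (B i) p) : Quotient (NpAdditiveStructure.isoSetoid n p) :=
    Quotient.mk _ ⟨B i, σ.1, realized i σ⟩
  have existsUnique_mem_range (q) : ∃! i, q ∈ Set.range (f i) := by
    induction q using Quotient.inductionOn with | h X => ?_
    obtain ⟨C, hC⟩ := X.realized
    obtain ⟨i, ⟨g⟩, -⟩ := hB X.B
    refine ⟨i, ⟨⟨X.σ.comp g.toMulEquiv.symm.toMonoidHom,
      comp_mem_braceHom hC.mem_braceHom g.symm.map_circ⟩,
      Quotient.sound ⟨g.symm, fun _ => rfl⟩⟩, ?_⟩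
    rintro j ⟨σ, hσ⟩
    obtain ⟨g', -⟩ := Quotient.exact hσ
    exact hB.eq_of_iso (g'.trans g)
  rw [NpAdditiveStructure.count, card_eq_sum_ncard_of_existsUnique existsUnique_mem_range
    fun i => Set.finite_range (f i), Nat.cast_sum]
  exact Finset.sum_congr rfl fun i _ => ncard_range_braceHom fun _ _ => Quotient.eq

end Classification

theorem mainTheorem5 (n p : ℕ) (hn : 0 < n) (hp : p.Prime) (hnp : ¬ p ∣ n)
    (hG : ∀ (G : Type) [Group G], Nat.card G = n * p →
      ∃ P : Subgroup G, P.Normal ∧ Nat.card P = p)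
    {ι : Type} [Fintype ι] (B : ι → FinSkewBrace n) (hB : IsReps B)
    (R : ∀ i, Set (B i →* (ZMod p)ˣ)) (hR : ∀ i, IsOrbitReps (R i)) :
    -- the number of additive structures, by stabilizers and by fixed points
    (NpAdditiveStructure.count n p : ℚ) =
        ∑ i, 1 / (Nat.card (autBrace (B i)) : ℚ) *
          ∑ᶠ σ ∈ braceHom (B i) p, (Nat.card ↥(autBrace (B i) ⊓ stabDot σ) : ℚ) ∧
    (NpAdditiveStructure.count n p : ℚ) =
        ∑ i, 1 / (Nat.card (autBrace (B i)) : ℚ) *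
          ∑ᶠ g ∈ autBrace (B i), (Nat.card (fixBraceHom p g) : ℚ) ∧
    -- the total number, by stabilizers and by fixed points
    (FinSkewBrace.count (n * p) : ℚ) =
        ∑ i, (1 / (Nat.card (autStab (1 : B i →* (ZMod p)ˣ)) : ℚ) *
            ∑ᶠ τ : Circ (B i) →* (ZMod p)ˣ,
              (Nat.card ↥(autStab (1 : B i →* (ZMod p)ˣ) ⊓ stabCirc τ) : ℚ) +
          2 * ∑ᶠ σ ∈ R i \ {1}, 1 / (Nat.card (autStab σ) : ℚ) *
            ∑ᶠ τ : Circ (B i) →* (ZMod p)ˣ, (Nat.card ↥(autStab σ ⊓ stabCirc τ) : ℚ)) ∧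
    (FinSkewBrace.count (n * p) : ℚ) =
        ∑ i, (1 / (Nat.card (autStab (1 : B i →* (ZMod p)ˣ)) : ℚ) *
            ∑ᶠ g ∈ autStab (1 : B i →* (ZMod p)ˣ), (Nat.card (fixCircHom p g) : ℚ) +
          2 * ∑ᶠ σ ∈ R i \ {1}, 1 / (Nat.card (autStab σ) : ℚ) *
            ∑ᶠ g ∈ autStab σ, (Nat.card (fixCircHom p g) : ℚ)) ∧
    -- the case `σ = 1`: semidirect products
    (∀ i, autStab (1 : B i →* (ZMod p)ˣ) = autBrace (B i) ∧
      (countWith (n * p) (fun C => ∃ τ, IsDoubleSemidirect C (1 : B i →* (ZMod p)ˣ) τ) : ℚ) =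
        1 / (Nat.card (autStab (1 : B i →* (ZMod p)ˣ)) : ℚ) *
          ∑ᶠ τ : Circ (B i) →* (ZMod p)ˣ,
            (Nat.card ↥(autStab (1 : B i →* (ZMod p)ˣ) ⊓ stabCirc τ) : ℚ)) ∧
    -- the cases `σ ≠ 1`: the two kinds of double semidirect products
    (∀ i, ∀ σ ∈ R i, σ ≠ 1 →
      (countWith (n * p) (fun C => ∃ τ, IsDoubleSemidirect C σ τ) : ℚ) =
        1 / (Nat.card (autStab σ) : ℚ) *
          ∑ᶠ τ : Circ (B i) →* (ZMod p)ˣ, (Nat.card ↥(autStab σ ⊓ stabCirc τ) : ℚ) ∧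
      (countWith (n * p) (fun C => ∃ τ, IsMirrorDoubleSemidirect C σ τ) : ℚ) =
        1 / (Nat.card (autStab σ) : ℚ) *
          ∑ᶠ τ : Circ (B i) →* (ZMod p)ˣ, (Nat.card ↥(autStab σ ⊓ stabCirc τ) : ℚ) ∧
      ∀ C : FinSkewBrace (n * p),
        ¬ ((∃ τ, IsDoubleSemidirect C σ τ) ∧ ∃ τ, IsMirrorDoubleSemidirect C σ τ)) ∧
    -- every skew brace of size `np` occurs, for exactly one `B i` and one `σ ∈ R i`
    (∀ C : FinSkewBrace (n * p), ∃! q : Σ i, R i,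
      ∃ τ, IsDoubleSemidirect C q.2.1 τ ∨ IsMirrorDoubleSemidirect C q.2.1 τ) := by
  have := NeZero.mk hp.ne_zero
  have hcop : n.Coprime p := (hp.coprime_iff_not_dvd.2 hnp).symm
  have hdouble (i) {σ} (hσ : σ ∈ braceHom (B i) p) := countWith_isDoubleSemidirect hcop hσ
  have hadditive := npAdditiveStructure_count_eq_sum (p := p) hB
  have hcount := count_mul_eq_sum hp hcop hG hB hR
  have hR_sum (i) := finsum_mem_congr (s := R i \ {1}) rfl
    fun σ (hσ : σ ∈ R i \ {1}) => hdouble i ((hR i).1 hσ.1)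
  simp only [hdouble _ one_mem_braceHom, hR_sum] at hcount
  refine ⟨hadditive, ?_, hcount, ?_, fun i => ⟨autStab_one, hdouble i one_mem_braceHom⟩,
    fun i σ hσ hσ1 => ⟨hdouble i ((hR i).1 hσ),
      countWith_isMirrorDoubleSemidirect hcop ((hR i).1 hσ), ?_⟩,
    existsUnique_isDoubleSemidirect_or hp hcop hG hB hR⟩
  · simpa only [finsum_card_stabDot_eq_finsum_card_fixBraceHom] using hadditive
  · simpa only [finsum_card_stabCirc_eq_finsum_card_fixCircHom] using hcount
  · rintro C ⟨⟨τ, h⟩, τ', h'⟩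
    exact hσ1 (eq_one_of_isDoubleSemidirect_of_isMirrorDoubleSemidirect
      (by rwa [(B i).card_eq]) h h')
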